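/- A chord diagram consists of finitely many straight chords of a circle with pairwise distinct endpoints. A circle graph is the intersection graph of a chord diagram: its vertices are the chords, and two distinct chords are adjacent if and only if they intersect. The independence complex $I(G)$ of a graph $G$ is the simplicial complex whose simplices are the nonempty independent sets of vertices of $G$. A wedge of $n\ge 1$ circles is a space obtained from a circle by attaching, $n-1$ times, a further circle $S^1$ to the existing wedge along an arbitrary point. Theorem. There is no bipartite circle graph $G$ for which (the geometric realization of) $I(G)$ is homotopy equivalent to a wedge of $n$ circles with $n\ge 3$. This bound is best possible: the hexagon (the cycle graph on six vertices) is a bipartite circle graph whose independence complex is homotopy equivalent to $S^1\vee S^1$. -/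

import Mathlib

/-- A chord diagram whose chords are labelled by `V`: every `v : V` has two endpoints on the unit
circle, and all these endpoints are pairwise distinct. -/
structure ChordDiagram (V : Type*) where
  /-- one endpoint of each chord -/
  fst : V → Circle
  /-- the other endpoint of each chord -/
  snd : V → Circle
  /-- all the endpoints of all the chords are pairwise distinct -/
  endpoints_injective : Function.Injective (Sum.elim fst snd)

/-- The chord with label `v`: the straight segment in the closed unit disc between its endpoints. -/
def ChordDiagram.chord {V : Type*} (D : ChordDiagram V) (v : V) : Set ℂ :=
  segment ℝ (D.fst v : ℂ) (D.snd v : ℂ)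

/-- The intersection graph of a chord diagram: the vertices are the chords, and two different chords
are adjacent exactly if they intersect. -/
def ChordDiagram.intersectionGraph {V : Type*} (D : ChordDiagram V) : SimpleGraph V where
  Adj v w := v ≠ w ∧ (D.chord v ∩ D.chord w).Nonempty
  symm := ⟨fun _ _ h => ⟨h.1.symm, by rw [Set.inter_comm]; exact h.2⟩⟩
  loopless := ⟨fun _ h => h.1 rfl⟩

/-- A circle graph is the intersection graph of a chord diagram. -/
def IsCircleGraph {V : Type*} (G : SimpleGraph V) : Prop :=
  ∃ D : ChordDiagram V, D.intersectionGraph = G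

/-- The independence complex of a graph: its simplices are the nonempty finite independent sets of
vertices. -/
def independenceComplex {V : Type*} (G : SimpleGraph V) : AbstractSimplicialComplex V where
  faces := {s | s.Nonempty ∧ G.IsIndepSet (s : Set V)}
  isRelLowerSet_faces := fun _ hs =>
    ⟨hs.1, fun _ hts ht => ⟨ht, hs.2.mono (Finset.coe_subset.mpr hts)⟩⟩
  singleton_mem := fun v => ⟨Finset.singleton_nonempty v, by simp⟩

/-- The geometric realization of a simplicial complex on a finite vertex set, with the topology
induced from `V → ℝ`: the points of the standard simplex (in barycentric coordinates) that are
supported on a simplex of the complex. -/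
def geometricRealization {V : Type*} [Fintype V] (K : AbstractSimplicialComplex V) :
    Set (V → ℝ) :=
  {x | x ∈ stdSimplex ℝ V ∧ ∃ s ∈ K.faces, ∀ v, x v ≠ 0 → v ∈ s}

/-- The relation on the disjoint union of `X` and `Y` that identifies `x₀` with `y₀`. -/
inductive WedgeRel {X Y : Type*} (x₀ : X) (y₀ : Y) : X ⊕ Y → X ⊕ Y → Prop
  | glue : WedgeRel x₀ y₀ (Sum.inl x₀) (Sum.inr y₀)

/-- The wedge sum `X ∨ Y` along the points `x₀` and `y₀`, with the quotient topology. -/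
abbrev WedgeSum {X Y : Type*} [TopologicalSpace X] [TopologicalSpace Y] (x₀ : X) (y₀ : Y) :=
  Quot (WedgeRel x₀ y₀)

/-- `IsWedgeOfCircles n X`: the space `X` is (homeomorphic to) a wedge of `n ≥ 1` circles, built up
iteratively from one circle by attaching, in each step, one more circle to the existing wedge along
an arbitrary point. The bouquet, where all circles share one point, is a special case. -/
inductive IsWedgeOfCircles.{u} : ℕ → (X : Type u) → [TopologicalSpace X] → Prop
  | circle {X : Type u} [TopologicalSpace X] : Nonempty (X ≃ₜ Circle) → IsWedgeOfCircles 1 X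
  | attach {n : ℕ} {Y X : Type u} [TopologicalSpace Y] [TopologicalSpace X] (y : Y) (z : Circle) :
      IsWedgeOfCircles n Y → Nonempty (X ≃ₜ WedgeSum y z) → IsWedgeOfCircles (n + 1) X

/-! Circle-valued maps detect first cohomology: a map to `Circle` is trivial when it lifts through
`Circle.exp` (`HasAngle`). A wedge of n circles retracts onto each of its circles, so a space
homotopy equivalent to it carries n maps no nontrivial monomial of which lifts
(`IsWedgeOfCircles.exists_independent`).

Let G be bipartite. Its independence complex is the union of the two halves where one colour has
weight at least 1/2. Each half contracts into the simplex on a colour class, so every map f has an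
angle on each half. On the common level set the two angles differ by a locally constant multiple of
2π, and f lifts globally once this multiple is constant. Three maps thus assign a vector in ℤ³ to
every nonadjacent pair (a, b) of opposite colours. If at most three vectors occurred, they would lie
in an affine plane m · d = n with m ≠ 0, and the monomial with exponents m would lift. So
independence yields four pairs (aᵢ, bᵢ) with distinct vectors. If aᵢ and bⱼ were nonadjacent for
some i ≠ j, two triangles would join the two pairs and equate their vectors. Hence G contains K₄,₄
minus a perfect matching (`exists_cube_of_independent`).

No chord diagram realizes this (`ChordDiagram.no_cube`): of the disjoint chords a₀, a₁, a₂ crossing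
b₃, the middle one aⱼ separates the others, so bⱼ, which meets both others, would have to cross aⱼ.

For the hexagon, the complex is two filled triangles joined by three edges between opposite
vertices. Collapsing the triangles and one edge leaves two circles; explicit piecewise-linear
formulas, contiguity and radial projection make this a homotopy equivalence
(`hexagon_homotopyEquiv`). -/

section Contiguous

variable {V Y : Type*} [Fintype V] [TopologicalSpace Y] {K : AbstractSimplicialComplex V}

/-- Two maps into the realization of a complex are homotopic if they are contiguous: at every point
their values lie in a common simplex. -/
theorem homotopic_of_contiguous (f g : C(Y, geometricRealization K))
    (h : ∀ y, ∃ s ∈ K.faces, (∀ v, (f y).1 v ≠ 0 → v ∈ s) ∧ ∀ v, (g y).1 v ≠ 0 → v ∈ s) :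
    f.Homotopic g := by
  refine ⟨⟨⟨fun p => ⟨(1 - (p.1 : ℝ)) • (f p.2).1 + (p.1 : ℝ) • (g p.2).1, ?_⟩, ?_⟩, ?_, ?_⟩⟩
  · obtain ⟨s, hs, hf, hg⟩ := h p.2
    refine ⟨convex_stdSimplex ℝ V (f p.2).2.1 (g p.2).2.1 (by linarith [p.1.2.2]) p.1.2.1
      (by ring), s, hs, fun v hv => ?_⟩
    by_contra hvs
    have h1 : (f p.2).1 v = 0 := by_contra fun h => hvs (hf v h)
    have h2 : (g p.2).1 v = 0 := by_contra fun h => hvs (hg v h)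
    simp [h1, h2] at hv
  · refine Continuous.subtype_mk ?_ _
    fun_prop
  · intro y; ext v; simp
  · intro y; ext v; simp

end Contiguous

/-! ### Lifting circle-valued maps through the exponential -/

section Angle

variable {X Y : Type*} [TopologicalSpace X] [TopologicalSpace Y]

/-- A circle-valued function has an angle function if it lifts through `Circle.exp` to a continuous
real-valued function. -/
def HasAngle (f : X → Circle) : Prop :=
  ∃ g : C(X, ℝ), ∀ x, Circle.exp (g x) = f x

theorem HasAngle.comp {f : X → Circle} (hf : HasAngle f) (k : C(Y, X)) : HasAngle (f ∘ k) :=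
  let ⟨g, hg⟩ := hf
  ⟨g.comp k, fun y => hg (k y)⟩

/-- Homotopy lifting for the covering `Circle.exp`: the lift of the homotopy, started at the given
angle, ends at an angle of the other map. -/
theorem HasAngle.of_homotopic {f₀ f₁ : C(X, Circle)} (h : f₀.Homotopic f₁) (hf : HasAngle f₀) :
    HasAngle f₁ := by
  obtain ⟨H⟩ := h
  obtain ⟨g, hg⟩ := hf
  have h0 : ∀ x, H.toContinuousMap (0, x) = Circle.exp (g x) := fun x => by
    rw [hg]; exact H.apply_zero x
  refine ⟨(Circle.isCoveringMap_exp.liftHomotopy H.toContinuousMap g h0).comp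
    ⟨fun x => (1, x), by fun_prop⟩, fun x => ?_⟩
  have := congrFun (Circle.isCoveringMap_exp.liftHomotopy_lifts H.toContinuousMap g h0) (1, x)
  exact this.trans (H.apply_one x)

theorem hasAngle_const (z : Circle) : HasAngle (fun _ : X => z) :=
  let ⟨r, hr⟩ := Circle.exp_surjective z
  ⟨.const X r, fun _ => hr⟩

theorem eq_zero_of_hasAngle_zpow {m : ℤ} {w : Circle}
    (h : HasAngle (fun z : Circle => w * z ^ m)) : m = 0 := by
  obtain ⟨g, hg⟩ := h
  -- Subtracting `m * t` makes the image under `Circle.exp` constant, hence the function itself;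
  -- comparing 0 with 2π, where `g` takes the same value, gives 2πm = 0.
  have key := Circle.isCoveringMap_exp.const_of_comp (A := ℝ)
    (g := fun t : ℝ => g (Circle.exp t) - m * t) (by fun_prop) (fun a a' => by
      have : ∀ t : ℝ, Circle.exp (g (Circle.exp t) - m * t) = w := fun t => by
        rw [Circle.exp_sub, hg, Circle.exp_intCast_mul]
        simp
      rw [this, this]) 0 (2 * Real.pi)
  simp only [Circle.exp_zero, Circle.exp_two_pi] at key
  have h2 : (m : ℝ) * (2 * Real.pi) = 0 := by linarith
  simpa [Real.pi_ne_zero] using h2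

end Angle

/-! ### Independent circle-valued maps on wedges of circles -/

/-- A wedge of `n` circles has `n` retractions onto its circles, each of which is constant on the
other circles. -/
theorem IsWedgeOfCircles.exists_dual_loops.{u} {n : ℕ} {X : Type u} [TopologicalSpace X]
    (h : IsWedgeOfCircles n X) :
    ∃ (f : Fin n → C(X, Circle)) (c : Fin n → C(Circle, X)),
      ∀ i j, if i = j then ∀ z, f i (c j z) = z else ∃ w, ∀ z, f i (c j z) = w := by
  induction h with
  | circle h =>
    obtain ⟨e⟩ := h
    refine ⟨fun _ => ⟨e, e.continuous⟩, fun _ => ⟨e.symm, e.symm.continuous⟩, fun i j => ?_⟩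
    simp [Subsingleton.elim i j]
  | @attach n Y X _ _ y z _ h ih =>
    obtain ⟨e⟩ := h
    obtain ⟨f, c, hfc⟩ := ih
    let F (u : C(Y, Circle)) (v : C(Circle, Circle)) (huv : u y = v z) :
        C(WedgeSum y z, Circle) :=
      ⟨Quot.lift (Sum.elim u v) (by rintro _ _ ⟨⟩; exact huv), continuous_quot_lift _ (by fun_prop)⟩
    let inl : C(Y, WedgeSum y z) := ⟨fun p => Quot.mk _ (Sum.inl p), by
      exact continuous_quot_mk.comp continuous_inl⟩
    let inr : C(Circle, WedgeSum y z) := ⟨fun p => Quot.mk _ (Sum.inr p), by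
      exact continuous_quot_mk.comp continuous_inr⟩
    -- Old retractions extend to the new circle by their value at the gluing point; the new
    -- retraction sends the old wedge to `z`.
    refine ⟨Fin.snoc (fun i => (F (f i) (.const _ (f i y)) rfl).comp e)
        ((F (.const _ z) (.id _) rfl).comp e),
      Fin.snoc (fun i => (e.symm : C(WedgeSum y z, X)).comp (inl.comp (c i)))
        ((e.symm : C(WedgeSum y z, X)).comp inr), fun i j => ?_⟩
    induction i using Fin.lastCases with
    | last =>
      induction j using Fin.lastCases with
      | last => simp [F, inr]
      | cast j =>
        rw [if_neg (Fin.castSucc_lt_last j).ne']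
        exact ⟨z, fun w => by simp [F, inl]⟩
    | cast i =>
      induction j using Fin.lastCases with
      | last =>
        rw [if_neg (Fin.castSucc_lt_last i).ne]
        exact ⟨f i y, fun w => by simp [F, inr]⟩
      | cast j =>
        have := hfc i j
        simpa [F, inl] using this

/-- A space homotopy equivalent to a wedge of at least `k` circles carries `k` circle-valued maps
that are multiplicatively independent up to homotopy. -/
theorem IsWedgeOfCircles.exists_independent {n k : ℕ} (hk : k ≤ n) {X K : Type*}
    [TopologicalSpace X] [TopologicalSpace K] (h : IsWedgeOfCircles n X)
    (e : ContinuousMap.HomotopyEquiv K X) :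
    ∃ f : Fin k → C(K, Circle), ∀ m : Fin k → ℤ,
      HasAngle (fun x => ∏ i, f i x ^ m i) → m = 0 := by
  obtain ⟨f, c, hfc⟩ := h.exists_dual_loops
  refine ⟨fun i => (f (Fin.castLE hk i)).comp e.toFun, fun m hm => funext fun j => ?_⟩
  let P : C(X, Circle) := ⟨fun x => ∏ i, f (Fin.castLE hk i) x ^ m i, by fun_prop⟩
  have h1 : HasAngle ((P.comp (e.toFun.comp e.invFun))) := hm.comp e.invFun
  have h2 : HasAngle P := h1.of_homotopic (by
    have := (ContinuousMap.Homotopic.refl P).comp e.right_inv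
    exact this)
  have h3 := h2.comp (c (Fin.castLE hk j))
  have hw : ∀ i : Fin k, ∃ w : Circle, ∀ z,
      f (Fin.castLE hk i) (c (Fin.castLE hk j) z) = if i = j then z else w := fun i => by
    have := hfc (Fin.castLE hk i) (Fin.castLE hk j)
    by_cases hij : i = j
    · subst hij
      exact ⟨1, by simpa using this⟩
    · rw [if_neg (by simpa using hij)] at this
      simpa [hij] using this
  choose w hw using hw
  -- On the `j`-th loop all factors but the `j`-th are constant, so the monomial becomes a constant
  -- times the `m j`-th power.
  refine eq_zero_of_hasAngle_zpow (w := ∏ i ∈ Finset.univ.erase j, w i ^ m i) ?_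
  convert! h3 using 2 with z
  simp only [P, Function.comp_apply, ContinuousMap.coe_mk, hw]
  rw [← Finset.prod_erase_mul _ _ (Finset.mem_univ j)]
  congr 1
  · exact Finset.prod_congr rfl fun i hi => by rw [if_neg (Finset.ne_of_mem_erase hi)]
  · simp

/-! ### Independence complexes of bipartite graphs -/

section Bipartite

variable {V : Type*} [Fintype V]

/-- The total weight that `x` puts on the vertices of colour `k`. -/
def colourWeight (c : V → Fin 2) (k : Fin 2) (x : V → ℝ) : ℝ :=
  ∑ v, if c v = k then x v else 0

omit [Fintype V] in
theorem continuous_ite_apply (c : V → Fin 2) (k : Fin 2) (v : V) :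
    Continuous fun x : V → ℝ => if c v = k then x v else 0 := by
  split_ifs <;> fun_prop

theorem continuous_colourWeight (c : V → Fin 2) (k : Fin 2) : Continuous (colourWeight c k) :=
  continuous_finsetSum _ fun v _ => continuous_ite_apply c k v

theorem colourWeight_add (c : V → Fin 2) {x : V → ℝ} (hx : x ∈ stdSimplex ℝ V) :
    colourWeight c 0 x + colourWeight c 1 x = 1 := by
  rw [← hx.2, colourWeight, colourWeight, ← Finset.sum_add_distrib]
  refine Finset.sum_congr rfl fun v _ => ?_
  rcases Fin.exists_fin_two.mp ⟨c v, rfl⟩ with h | h <;> simp [h]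

theorem colourWeight_combo (c : V → Fin 2) (k : Fin 2) (x y : V → ℝ) (s t : ℝ) :
    colourWeight c k (s • x + t • y) = s * colourWeight c k x + t * colourWeight c k y := by
  simp only [colourWeight, Finset.mul_sum, ← Finset.sum_add_distrib]
  refine Finset.sum_congr rfl fun v _ => ?_
  split_ifs <;> simp

theorem exists_ne_zero_of_colourWeight_ne_zero {c : V → Fin 2} {k : Fin 2} {x : V → ℝ}
    (h : colourWeight c k x ≠ 0) : ∃ v, c v = k ∧ x v ≠ 0 := by
  obtain ⟨v, -, hv⟩ := Finset.exists_ne_zero_of_sum_ne_zero h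
  exact ⟨v, by_contra fun h => hv (if_neg h), fun h => hv (by simp [h])⟩

open Classical in
/-- The midpoint of the segment between two vertices, in barycentric coordinates. -/
noncomputable def edgeMidpoint (a b : V) : V → ℝ :=
  (1 / 2 : ℝ) • Pi.single a 1 + (1 / 2 : ℝ) • Pi.single b 1

theorem edgeMidpoint_mem_stdSimplex (a b : V) : edgeMidpoint a b ∈ stdSimplex ℝ V := by
  classical
  convert! convex_stdSimplex ℝ V (single_mem_stdSimplex ℝ a) (single_mem_stdSimplex ℝ b)
    (a := 1 / 2) (b := 1 / 2) (by norm_num) (by norm_num) (by norm_num) using 2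

omit [Fintype V] in
theorem eq_or_eq_of_edgeMidpoint_ne_zero {a b v : V} (h : edgeMidpoint a b v ≠ 0) :
    v = a ∨ v = b := by
  by_contra! hv
  simp [edgeMidpoint, hv.1, hv.2] at h

theorem colourWeight_edgeMidpoint {c : V → Fin 2} {a b : V} (ha : c a = 0) (hb : c b = 1)
    (k : Fin 2) : colourWeight c k (edgeMidpoint a b) = 1 / 2 := by
  classical
  have h1 : ∀ d : V, colourWeight c k (Pi.single d 1) = if c d = k then 1 else 0 := fun d => by
    rw [colourWeight, Finset.sum_eq_single d]
    · simp
    · intro v _ hv; simp [hv]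
    · simp
  have : edgeMidpoint a b = (1 / 2 : ℝ) • Pi.single a 1 + (1 / 2 : ℝ) • Pi.single b 1 := by
    simp only [edgeMidpoint]
  rw [this, colourWeight_combo, h1, h1, ha, hb]
  fin_cases k <;> simp

variable {G : SimpleGraph V}

local notation "K" => geometricRealization (independenceComplex G)

omit [Fintype V] in
theorem isIndepSet_colourClass (c : G.Coloring (Fin 2)) (k : Fin 2) :
    G.IsIndepSet {v | c v = k} := fun _ hv _ hw _ h => c.valid h (hv.trans hw.symm)

/-- The part of the independence complex of a bipartite graph where one colour has weight at least
`1 / 2` is contractible, so circle-valued functions have an angle on it. -/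
theorem exists_angle_on_half (c : G.Coloring (Fin 2)) (k : Fin 2) (f : C(K, Circle)) :
    ∃ g : K → ℝ, ContinuousOn g {x | 1 / 2 ≤ colourWeight c k x.1} ∧
      ∀ x : K, 1 / 2 ≤ colourWeight c k x.1 → Circle.exp (g x) = f x := by
  classical
  let C := {x : K // 1 / 2 ≤ colourWeight c k x.1}
  suffices h : HasAngle fun x : C => f x.1 by
    obtain ⟨g, hg⟩ := h
    -- The value 0 off the half is arbitrary: only continuity on the half is claimed.
    refine ⟨fun x => if hx : 1 / 2 ≤ colourWeight c k x.1 then g ⟨x, hx⟩ else 0, ?_, fun x hx => ?_⟩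
    · rw [continuousOn_iff_continuous_domRestrict]
      convert! g.continuous using 1
      funext x
      exact dif_pos x.2
    · simp only [dif_pos hx]
      exact hg ⟨x, hx⟩
  rcases isEmpty_or_nonempty C with hC | ⟨⟨y⟩⟩
  · exact ⟨⟨fun x => hC.elim x, continuous_of_const fun x => hC.elim x⟩, fun x => hC.elim x⟩
  have hpos : ∀ x : C, 0 < colourWeight c k x.1.1 := fun x => lt_of_lt_of_le (by norm_num) x.2
  obtain ⟨a, ha, -⟩ := exists_ne_zero_of_colourWeight_ne_zero (hpos y).ne'
  let A : Finset V := Finset.univ.filter fun v => c v = k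
  have hA : A ∈ (independenceComplex G).faces :=
    ⟨⟨a, by simp [A, ha]⟩, by simpa [A] using isIndepSet_colourClass c k⟩
  let i : C(C, K) := ⟨Subtype.val, continuous_subtype_val⟩
  let r : C(C, K) := ⟨fun x => ⟨fun v => (if c v = k then x.1.1 v else 0) / colourWeight c k x.1.1,
      ⟨fun v => div_nonneg (by split_ifs <;> simp [x.1.2.1.1 v]) (hpos x).le, by
        rw [← Finset.sum_div]
        exact div_self (hpos x).ne'⟩,
      A, hA, fun v hv => by
        have : c v = k := by_contra fun h => hv (by simp [h])
        simp [A, this]⟩, by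
    refine Continuous.subtype_mk (continuous_pi fun v => ?_) _
    refine Continuous.div ?_ ?_ fun x => (hpos x).ne'
    · exact (continuous_ite_apply c k v).comp (continuous_subtype_val.comp continuous_subtype_val)
    · exact (continuous_colourWeight c k).comp (continuous_subtype_val.comp continuous_subtype_val)⟩
  let p : C(C, K) := .const C ⟨Pi.single a 1, single_mem_stdSimplex ℝ a, A, hA, fun v hv => by
    have : v = a := by_contra fun h => hv (by simp [h])
    simp [A, this, ha]⟩
  -- Discarding the other colour and renormalizing only shrinks the support, so a point and its
  -- image share a simplex.
  have hir : i.Homotopic r := homotopic_of_contiguous _ _ fun x => by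
    obtain ⟨s, hs, hxs⟩ := x.1.2.2
    refine ⟨s, hs, hxs, fun v hv => hxs v fun h => hv ?_⟩
    simp [r, h]
  have hrp : r.Homotopic p := homotopic_of_contiguous _ _ fun x => by
    refine ⟨A, hA, fun v hv => ?_, fun v hv => ?_⟩
    · have : c v = k := by_contra fun h => hv (by simp [r, h])
      simp [A, this]
    · have : v = a := by_contra fun h => hv (by simp [p, h])
      simp [A, this, ha]
  exact HasAngle.of_homotopic (f₀ := f.comp p) (f₁ := f.comp i)
    ((ContinuousMap.Homotopic.refl f).comp (hir.trans hrp).symm) (hasAngle_const (f (p y)))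

/-- The difference of two angles of the same function is constant on the part of each simplex where
both colours have weight `1 / 2`. -/
theorem angle_sub_eq {c : G.Coloring (Fin 2)} {f : C(K, Circle)} {g₀ g₁ : K → ℝ}
    (hc₀ : ContinuousOn g₀ {x | 1 / 2 ≤ colourWeight c 0 x.1})
    (hc₁ : ContinuousOn g₁ {x | 1 / 2 ≤ colourWeight c 1 x.1})
    (hg₀ : ∀ x : K, 1 / 2 ≤ colourWeight c 0 x.1 → Circle.exp (g₀ x) = f x)
    (hg₁ : ∀ x : K, 1 / 2 ≤ colourWeight c 1 x.1 → Circle.exp (g₁ x) = f x)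
    {x y : K} (hx : ∀ k, colourWeight c k x.1 = 1 / 2) (hy : ∀ k, colourWeight c k y.1 = 1 / 2)
    {s : Finset V} (hs : s ∈ (independenceComplex G).faces) (hxs : ∀ v, x.1 v ≠ 0 → v ∈ s)
    (hys : ∀ v, y.1 v ≠ 0 → v ∈ s) : g₀ x - g₁ x = g₀ y - g₁ y := by
  let γ : unitInterval → K := fun t => ⟨(1 - (t : ℝ)) • x.1 + (t : ℝ) • y.1,
    convex_stdSimplex ℝ V x.2.1 y.2.1 (by linarith [t.2.2]) t.2.1 (by ring), s, hs, fun v hv => by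
      by_contra hvs
      have h1 : x.1 v = 0 := by_contra fun h => hvs (hxs v h)
      have h2 : y.1 v = 0 := by_contra fun h => hvs (hys v h)
      simp [h1, h2] at hv⟩
  have hγ : Continuous γ := Continuous.subtype_mk (by fun_prop) _
  -- Colour weights are linear, so the segment stays in the level set, where both angles are
  -- continuous.
  have hw : ∀ t k, 1 / 2 ≤ colourWeight c k (γ t).1 := fun t k => by
    simp only [γ, colourWeight_combo, hx, hy]
    linarith
  have key := Circle.isCoveringMap_exp.const_of_comp (A := unitInterval)
    (g := fun t => g₀ (γ t) - g₁ (γ t))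
    ((hc₀.comp_continuous hγ fun t => hw t 0).sub (hc₁.comp_continuous hγ fun t => hw t 1))
    (fun t t' => by simp [Circle.exp_sub, hg₀ _ (hw _ 0), hg₁ _ (hw _ 1)]) 0 1
  simpa [γ] using key

/-- A function whose angles on the two halves differ by a constant has a global angle. -/
theorem hasAngle_of_angle_sub_eq {c : G.Coloring (Fin 2)} {f : K → Circle} {g₀ g₁ : K → ℝ}
    (hc₀ : ContinuousOn g₀ {x | 1 / 2 ≤ colourWeight c 0 x.1})
    (hc₁ : ContinuousOn g₁ {x | 1 / 2 ≤ colourWeight c 1 x.1})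
    (hg₀ : ∀ x : K, 1 / 2 ≤ colourWeight c 0 x.1 → Circle.exp (g₀ x) = f x)
    (hg₁ : ∀ x : K, 1 / 2 ≤ colourWeight c 1 x.1 → Circle.exp (g₁ x) = f x)
    (n : ℤ) (h : ∀ x : K, (∀ k, colourWeight c k x.1 = 1 / 2) → g₀ x - g₁ x = n * (2 * Real.pi)) :
    HasAngle f := by
  classical
  have hadd : ∀ x : K, colourWeight c 0 x.1 + colourWeight c 1 x.1 = 1 :=
    fun x => colourWeight_add c x.2.1
  refine ⟨⟨fun x : K => if (1 / 2 : ℝ) ≤ colourWeight c 0 x.1 then g₀ x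
      else g₁ x + n * (2 * Real.pi), ?_⟩, fun x => ?_⟩
  · refine continuous_if_le continuous_const
      ((continuous_colourWeight c 0).comp continuous_subtype_val) hc₀ ?_ fun x hx => ?_
    · refine (hc₁.add continuousOn_const).mono fun x hx => ?_
      have := hadd x
      simp only [Set.mem_ofPred_eq] at hx ⊢
      linarith
    · have := hadd x
      have h1 := h x (Fin.forall_fin_two.mpr ⟨hx.symm, by linarith⟩)
      linarith
  · have := hadd x
    simp only [ContinuousMap.coe_mk]
    split_ifs with hx
    · exact hg₀ x hx
    · rw [Circle.exp_add, Circle.exp_int_mul_two_pi, mul_one]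
      exact hg₁ x (by linarith)

/-- Integer vectors of dimension three that take at most three values satisfy a nontrivial affine
equation. -/
theorem exists_affine_relation {E : Type*} (d : E → Fin 3 → ℤ)
    (h : ¬ ∃ e : Fin 4 → E, ∀ i j, d (e i) = d (e j) → i = j) :
    ∃ m : Fin 3 → ℤ, m ≠ 0 ∧ ∃ n : ℤ, ∀ e, ∑ i, m i * d e i = n := by
  have h2 : ∃ p : Fin 3 → Fin 3 → ℤ, ∀ e, ∃ i, d e = p i := by
    classical
    by_cases hS : (Set.range d).Finite ∧ (Set.range d).ncard ≤ 3
    · have := hS.1.fintype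
      obtain ⟨q⟩ := Function.Embedding.nonempty_of_card_le (α := Set.range d) (β := Fin 3)
        (by rw [← Nat.card_eq_fintype_card, Nat.card_coe_set_eq, Fintype.card_fin]; exact hS.2)
      -- Indices beyond the actual values of `d` are padded with 0.
      refine ⟨fun i => if h : ∃ x, q x = i then h.choose.1 else 0, fun e => ⟨q ⟨d e, e, rfl⟩, ?_⟩⟩
      have hex : ∃ x, q x = q ⟨d e, e, rfl⟩ := ⟨_, rfl⟩
      simp only [dif_pos hex, q.injective hex.choose_spec]
    · exfalso
      have : ∃ t : Set (Fin 3 → ℤ), t ⊆ Set.range d ∧ t.ncard = 4 ∧ t.Finite := by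
        by_cases hf : (Set.range d).Finite
        · obtain ⟨t, ht, ht4⟩ := Set.exists_subset_card_eq (s := Set.range d) (n := 4)
            (by by_contra hlt; exact hS ⟨hf, by omega⟩)
          exact ⟨t, ht, ht4, hf.subset ht⟩
        · obtain ⟨t, ht, htf, ht4⟩ := Set.Infinite.exists_subset_ncard_eq hf 4
          exact ⟨t, ht, ht4, htf⟩
      obtain ⟨t, ht, ht4, htf⟩ := this
      have := htf.fintype
      obtain ⟨q⟩ := Function.Embedding.nonempty_of_card_le (α := Fin 4) (β := t)
        (by rw [← Nat.card_eq_fintype_card (α := t), Nat.card_coe_set_eq, Fintype.card_fin, ht4])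
      choose e he using fun i => ht (q i).2
      exact h ⟨e, fun i j hij => q.injective (Subtype.ext (by rw [← he, ← he, hij]))⟩
  obtain ⟨p, hp⟩ := h2
  -- Subtracting `p 0` makes row 0 of the matrix vanish; an integer kernel vector is orthogonal to
  -- all differences of the three values.
  obtain ⟨m, hm, hm0⟩ := (Matrix.exists_mulVec_eq_zero_iff
    (M := Matrix.of fun i j => p i j - p 0 j)).mpr
      (Matrix.det_eq_zero_of_row_eq_zero 0 fun j => by simp)
  refine ⟨m, hm, ∑ i, m i * p 0 i, fun e => ?_⟩
  obtain ⟨j, hj⟩ := hp e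
  have := congrFun hm0 j
  simp only [Matrix.mulVec, dotProduct, Matrix.of_apply, Pi.zero_apply, sub_mul,
    Finset.sum_sub_distrib] at this
  rw [hj]
  simp only [mul_comm (m _)]
  linarith

/-- If the independence complex of a bipartite graph carries three independent circle-valued maps,
the graph contains the cube: `K₄,₄` without a perfect matching. -/
theorem exists_cube_of_independent (c : G.Coloring (Fin 2)) (f : Fin 3 → C(K, Circle))
    (hf : ∀ m : Fin 3 → ℤ, HasAngle (fun x => ∏ i, f i x ^ m i) → m = 0) :
    ∃ a b : Fin 4 → V, (∀ i, c (a i) = 0) ∧ (∀ i, c (b i) = 1) ∧ (∀ i, ¬ G.Adj (a i) (b i)) ∧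
      ∀ i j, i ≠ j → G.Adj (a i) (b j) := by
  classical
  choose g hgc hg using fun (k : Fin 2) (i : Fin 3) => exists_angle_on_half c k (f i)
  let E := {e : V × V // c e.1 = 0 ∧ c e.2 = 1 ∧ ¬ G.Adj e.1 e.2}
  have hface : ∀ s : Finset V, s.Nonempty → (∀ v ∈ s, ∀ w ∈ s, c v = 0 → c w = 1 → ¬ G.Adj v w) →
      s ∈ (independenceComplex G).faces := fun s hne hs => ⟨hne, fun v hv w hw _ h => by
    have hvw := c.valid h
    rcases Fin.exists_fin_two.mp ⟨c v, rfl⟩ with h1 | h1 <;>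
      rcases Fin.exists_fin_two.mp ⟨c w, rfl⟩ with h2 | h2
    · exact hvw (h1.trans h2.symm)
    · exact hs v hv w hw h1 h2 h
    · exact hs w hw v hv h2 h1 h.symm
    · exact hvw (h1.trans h2.symm)⟩
  let mid : E → K := fun e => ⟨edgeMidpoint e.1.1 e.1.2, edgeMidpoint_mem_stdSimplex _ _,
    {e.1.1, e.1.2}, hface _ (by simp) (by
      obtain ⟨⟨a, b⟩, ha, hb, hab⟩ := e
      simp only at ha hb hab
      simp [ha, hb, hab]), fun v hv => by
      simpa using eq_or_eq_of_edgeMidpoint_ne_zero hv⟩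
  have hmid : ∀ e k, colourWeight c k (mid e).1 = 1 / 2 :=
    fun e k => colourWeight_edgeMidpoint e.2.1 e.2.2.1 k
  have hdiff : ∀ (i : Fin 3) (x : K), (∀ k, colourWeight c k x.1 = 1 / 2) →
      ∃ n : ℤ, g 0 i x - g 1 i x = n * (2 * Real.pi) := fun i x hx => by
    obtain ⟨n, hn⟩ := Circle.exp_eq_exp.mp ((hg 0 i x (hx 0).ge).trans (hg 1 i x (hx 1).ge).symm)
    exact ⟨n, by linarith⟩
  choose d hd using fun (e : E) (i : Fin 3) => hdiff i (mid e) (hmid e)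
  have hpi : (2 * Real.pi) ≠ 0 := by positivity
  have hdeq : ∀ (e e' : E) (s : Finset V), s ∈ (independenceComplex G).faces → e.1.1 ∈ s →
      e.1.2 ∈ s → e'.1.1 ∈ s → e'.1.2 ∈ s → d e = d e' := fun e e' s hs h1 h2 h3 h4 => by
    funext i
    have := angle_sub_eq (hgc 0 i) (hgc 1 i) (hg 0 i) (hg 1 i) (hmid e) (hmid e') hs
      (fun v hv => by rcases eq_or_eq_of_edgeMidpoint_ne_zero hv with rfl | rfl <;> assumption)
      (fun v hv => by rcases eq_or_eq_of_edgeMidpoint_ne_zero hv with rfl | rfl <;> assumption)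
    rw [hd, hd] at this
    exact_mod_cast mul_right_cancel₀ hpi this
  by_cases h4 : ∃ e : Fin 4 → E, ∀ i j, d (e i) = d (e j) → i = j
  · obtain ⟨e, he⟩ := h4
    refine ⟨fun i => (e i).1.1, fun i => (e i).1.2, fun i => (e i).2.1, fun i => (e i).2.2.1,
      fun i => (e i).2.2.2, fun i j hij => ?_⟩
    by_contra hadj
    refine hij (he i j ?_)
    -- The pair (aᵢ, bⱼ) shares a triangle with each of the pairs i and j, so all three have the
    -- same vector.
    let e' : E := ⟨((e i).1.1, (e j).1.2), (e i).2.1, (e j).2.2.1, hadj⟩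
    have hi := (e i).2
    have hj := (e j).2
    refine (hdeq (e i) e' {(e i).1.1, (e i).1.2, (e j).1.2} (hface _ (by simp) ?_)
      (by simp) (by simp) (by simp [e']) (by simp [e'])).trans
      (hdeq e' (e j) {(e i).1.1, (e j).1.1, (e j).1.2} (hface _ (by simp) ?_)
      (by simp [e']) (by simp [e']) (by simp) (by simp))
    · simp [hi.1, hi.2.1, hi.2.2, hj.2.1, hadj]
    · simp [hi.1, hj.1, hj.2.2, hj.2.1, hadj]
  · exfalso
    obtain ⟨m, hm0, n, hmn⟩ := exists_affine_relation d h4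
    refine hm0 (hf m ?_)
    refine hasAngle_of_angle_sub_eq (c := c) (g₀ := fun x => ∑ i, m i * g 0 i x)
      (g₁ := fun x => ∑ i, m i * g 1 i x)
      (continuousOn_finsetSum _ fun i _ => continuousOn_const.mul (hgc 0 i))
      (continuousOn_finsetSum _ fun i _ => continuousOn_const.mul (hgc 1 i)) ?_ ?_ n ?_
    · intro x hx
      simp [Fin.sum_univ_three, Fin.prod_univ_three, Circle.exp_add, hg 0 _ x hx]
    · intro x hx
      simp [Fin.sum_univ_three, Fin.prod_univ_three, Circle.exp_add, hg 1 _ x hx]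
    · intro x hx
      obtain ⟨s, hs, hxs⟩ := x.2.2
      obtain ⟨a, ha, hxa⟩ := exists_ne_zero_of_colourWeight_ne_zero (c := c) (k := 0) (x := x.1)
        (by rw [hx]; norm_num)
      obtain ⟨b, hb, hxb⟩ := exists_ne_zero_of_colourWeight_ne_zero (c := c) (k := 1) (x := x.1)
        (by rw [hx]; norm_num)
      -- Every point of the level set has a vertex of each colour in its support, so it shares a
      -- simplex with the midpoint of such a pair.
      let e : E := ⟨(a, b), ha, hb, fun h => hs.2 (hxs a hxa) (hxs b hxb) h.ne h⟩
      have key : ∀ i, g 0 i x - g 1 i x = d e i * (2 * Real.pi) := fun i => by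
        rw [← hd]
        exact angle_sub_eq (hgc 0 i) (hgc 1 i) (hg 0 i) (hg 1 i) hx (hmid e) hs hxs
          fun v hv => by
            rcases eq_or_eq_of_edgeMidpoint_ne_zero hv with rfl | rfl
            exacts [hxs _ hxa, hxs _ hxb]
      rw [← Finset.sum_sub_distrib, ← hmn e]
      push_cast
      rw [Finset.sum_mul]
      refine Finset.sum_congr rfl fun i _ => ?_
      rw [← mul_sub, key]; ring

end Bipartite

/-! ### Sides of a line and chords of the circle -/

section ChordGeometry

/-- The signed area that tells on which side of the line through `p` and `q` the point `z` lies. -/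
def lineSide (p q z : ℂ) : ℝ :=
  (q.re - p.re) * (z.im - p.im) - (q.im - p.im) * (z.re - p.re)

theorem lineSide_lineMap (p q x y : ℂ) (t : ℝ) :
    lineSide p q (AffineMap.lineMap x y t) = (1 - t) * lineSide p q x + t * lineSide p q y := by
  simp [lineSide, AffineMap.lineMap_apply]; ring

theorem exists_lineSide_eq_zero {p q x y : ℂ} (h : lineSide p q x * lineSide p q y ≤ 0) :
    ∃ z ∈ segment ℝ x y, lineSide p q z = 0 := by
  set a := lineSide p q x with ha
  set b := lineSide p q y with hb
  by_cases hab : a = b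
  · exact ⟨x, left_mem_segment ℝ x y, by rw [← ha]; nlinarith⟩
  have hab' : a - b ≠ 0 := sub_ne_zero.mpr hab
  have hsq : 0 < (a - b) ^ 2 := by positivity
  -- The side is affine along the segment, with values a and b at the ends, so it vanishes at
  -- parameter a / (a - b).
  refine ⟨AffineMap.lineMap x y (a / (a - b)), ?_, ?_⟩
  · rw [segment_eq_image_lineMap]
    refine ⟨_, ⟨?_, ?_⟩, rfl⟩
    · rw [show a / (a - b) = (a * (a - b)) / (a - b) ^ 2 by field_simp]
      exact div_nonneg (by nlinarith) hsq.le
    · rw [show a / (a - b) = (a * (a - b)) / (a - b) ^ 2 by field_simp, div_le_one hsq]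
      nlinarith
  · rw [lineSide_lineMap, ← ha, ← hb]
    field_simp; ring

theorem sq_add_sq_eq_one (z : Circle) : (z : ℂ).re ^ 2 + (z : ℂ).im ^ 2 = 1 := by
  have := Circle.normSq_coe z
  rw [Complex.normSq_apply] at this
  linarith

/-- A point of the line at parameter s has squared norm 1 - s(1 - s)N, where N is the squared length
of the chord; being in the disc forces 0 ≤ s ≤ 1. -/
theorem mem_segment_of_lineSide_eq_zero {p q : Circle} (hpq : p ≠ q) {z : ℂ}
    (hz : z.re ^ 2 + z.im ^ 2 ≤ 1) (h : lineSide p q z = 0) : z ∈ segment ℝ (p : ℂ) (q : ℂ) := by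
  obtain ⟨a, b⟩ := z
  have hp := sq_add_sq_eq_one p
  have hq := sq_add_sq_eq_one q
  have hne : ((q : ℂ).re - (p : ℂ).re) ^ 2 + ((q : ℂ).im - (p : ℂ).im) ^ 2 > 0 := by
    by_contra hcon
    apply hpq
    have h1 : (q : ℂ).re - (p : ℂ).re = 0 := by nlinarith [sq_nonneg ((q : ℂ).im - (p : ℂ).im), sq_nonneg ((q : ℂ).re - (p : ℂ).re)]
    have h2 : (q : ℂ).im - (p : ℂ).im = 0 := by nlinarith [sq_nonneg ((q : ℂ).im - (p : ℂ).im), sq_nonneg ((q : ℂ).re - (p : ℂ).re)]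
    exact Subtype.ext (Complex.ext (by linarith) (by linarith))
  simp only [lineSide] at h hz
  rw [segment_eq_image_lineMap]
  generalize (p : ℂ) = P at *
  generalize (q : ℂ) = Q at *
  obtain ⟨p1, p2⟩ := P
  obtain ⟨q1, q2⟩ := Q
  simp only at *
  set u := q1 - p1
  set v := q2 - p2
  set N := u ^ 2 + v ^ 2 with hN
  set s := (u * (a - p1) + v * (b - p2)) / N with hs
  have hsN : s * N = u * (a - p1) + v * (b - p2) := by rw [hs]; field_simp
  have ea : a = p1 + s * u := by
    have : N * (a - p1) = N * (s * u) := by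
      linear_combination (-u) * hsN - v * h + (a - p1) * hN
    have := mul_left_cancel₀ hne.ne' this
    linarith
  have eb : b = p2 + s * v := by
    have : N * (b - p2) = N * (s * v) := by
      linear_combination (-v) * hsN + u * h + (b - p2) * hN
    have := mul_left_cancel₀ hne.ne' this
    linarith
  have hs2 : s * (1 - s) * N ≥ 0 := by
    have e1 : a ^ 2 + b ^ 2 = (1 - s) * (p1 ^ 2 + p2 ^ 2) + s * (q1 ^ 2 + q2 ^ 2)
        - s * (1 - s) * N := by
      rw [ea, eb, hN]; simp only [u, v]; ring
    rw [hp, hq] at e1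
    linarith
  have hs3 : s * (1 - s) ≥ 0 := nonneg_of_mul_nonneg_left hs2 hne
  refine ⟨s, ⟨by nlinarith, by nlinarith⟩, ?_⟩
  apply Complex.ext <;> simp [AffineMap.lineMap_apply] <;> simp only [u, v] at * <;> linarith

end ChordGeometry

/-! ### The cube is not a circle graph -/

namespace ChordDiagram

variable {V : Type*} (D : ChordDiagram V)

/-- The position of `z` relative to the line that carries the chord of `v`. -/
def side (v : V) (z : ℂ) : ℝ := lineSide (D.fst v) (D.snd v) z

theorem fst_ne_snd (v : V) : D.fst v ≠ D.snd v := fun h =>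
  Sum.inl_ne_inr (D.endpoints_injective (a₁ := Sum.inl v) (a₂ := Sum.inr v) h)

theorem sq_add_sq_le_of_mem_chord {v : V} {z : ℂ} (hz : z ∈ D.chord v) :
    z.re ^ 2 + z.im ^ 2 ≤ 1 := by
  have h : z ∈ Metric.closedBall (0 : ℂ) 1 :=
    (convex_closedBall (0 : ℂ) 1).segment_subset (by simp [Circle.norm_coe]) (by simp [Circle.norm_coe]) hz
  rw [mem_closedBall_zero_iff] at h
  have h2 := Complex.sq_norm z
  rw [Complex.normSq_apply] at h2
  nlinarith [norm_nonneg z]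

theorem mem_chord_of_side_eq_zero {v w : V} {z : ℂ} (hz : z ∈ D.chord w) (h : D.side v z = 0) :
    z ∈ D.chord v :=
  mem_segment_of_lineSide_eq_zero (D.fst_ne_snd v) (D.sq_add_sq_le_of_mem_chord hz) h

theorem side_eq_zero_of_mem_chord {v : V} {z : ℂ} (hz : z ∈ D.chord v) : D.side v z = 0 := by
  rw [chord, segment_eq_image_lineMap] at hz
  obtain ⟨t, -, rfl⟩ := hz
  rw [side, lineSide_lineMap]
  simp only [lineSide]; ring

/-- A chord disjoint from the chord of `v` lies on one side of it. -/
theorem side_mul_side_pos {v w : V} (h : ¬ (D.chord v ∩ D.chord w).Nonempty) {x y : ℂ}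
    (hx : x ∈ D.chord w) (hy : y ∈ D.chord w) : 0 < D.side v x * D.side v y := by
  by_contra hcon
  obtain ⟨z, hz, hz0⟩ := exists_lineSide_eq_zero (not_lt.mp hcon)
  have hzw : z ∈ D.chord w := (convex_segment (D.fst w : ℂ) (D.snd w : ℂ)).segment_subset hx hy hz
  exact h ⟨z, D.mem_chord_of_side_eq_zero hzw hz0, hzw⟩

/-- Two different chords intersect exactly if the endpoints of the second lie on different sides
of the first. -/
theorem chord_inter_chord_nonempty_iff {v w : V} :
    (D.chord v ∩ D.chord w).Nonempty ↔ D.side v (D.fst w) * D.side v (D.snd w) ≤ 0 := by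
  constructor
  · rintro ⟨z, hzv, hzw⟩
    have h0 := D.side_eq_zero_of_mem_chord hzv
    rw [chord, segment_eq_image_lineMap] at hzw
    obtain ⟨t, ⟨ht0, ht1⟩, rfl⟩ := hzw
    rw [side, lineSide_lineMap] at h0
    change lineSide _ _ _ * lineSide _ _ _ ≤ 0
    set a := lineSide (D.fst v) (D.snd v) (D.fst w)
    set b := lineSide (D.fst v) (D.snd v) (D.snd w)
    by_contra hcon
    push Not at hcon
    rcases pos_and_pos_or_neg_and_neg_of_mul_pos hcon with ⟨ha, hb⟩ | ⟨ha, hb⟩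
    · rcases ht0.eq_or_lt with rfl | ht
      · simp at h0; linarith
      · have := mul_pos ht hb
        have := mul_nonneg (sub_nonneg.mpr ht1) ha.le
        linarith
    · rcases ht0.eq_or_lt with rfl | ht
      · simp at h0; linarith
      · have := mul_neg_of_pos_of_neg ht hb
        have := mul_nonpos_of_nonneg_of_nonpos (sub_nonneg.mpr ht1) ha.le
        linarith
  · intro h
    by_contra hcon
    exact absurd (D.side_mul_side_pos hcon (left_mem_segment ℝ _ _) (right_mem_segment ℝ _ _))
      (not_lt.mpr h)

/-- If a chord meets three pairwise disjoint chords, and meets that of `v` between the other two,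
then every chord that meets the other two meets that of `v`. -/
theorem inter_nonempty_of_between {u v w b : V} {x y z : ℂ}
    (huv : ¬ (D.chord v ∩ D.chord u).Nonempty) (hwv : ¬ (D.chord v ∩ D.chord w).Nonempty)
    (hx : x ∈ D.chord u) (hy : y ∈ D.chord v) (hz : z ∈ D.chord w)
    (hyxz : y ∈ segment ℝ x z) (hbu : (D.chord u ∩ D.chord b).Nonempty)
    (hbw : (D.chord w ∩ D.chord b).Nonempty) : (D.chord v ∩ D.chord b).Nonempty := by
  by_contra hcon
  obtain ⟨x', hx'u, hx'b⟩ := hbu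
  obtain ⟨z', hz'w, hz'b⟩ := hbw
  have h1 := D.side_mul_side_pos hcon hx'b hz'b
  have h2 := D.side_mul_side_pos huv hx hx'u
  have h3 := D.side_mul_side_pos hwv hz hz'w
  have h0 := D.side_eq_zero_of_mem_chord hy
  rw [segment_eq_image_lineMap] at hyxz
  obtain ⟨t, ⟨ht0, ht1⟩, rfl⟩ := hyxz
  rw [side, lineSide_lineMap] at h0
  change (1 - t) * D.side v x + t * D.side v z = 0 at h0
  -- The product of `h1`, `h2`, `h3` is the side product of x and z times a square. So x and z lie
  -- strictly on the same side of v, although y between them lies on v.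
  have h4 : 0 < D.side v x * D.side v z := by
    have := mul_pos h1 (mul_pos h2 h3)
    by_contra hneg
    nlinarith [sq_nonneg (D.side v x' * D.side v z')]
  have h5 : (1 - t) * D.side v x ^ 2 + t * (D.side v x * D.side v z) = 0 := by
    linear_combination D.side v x * h0
  have h6 : 0 ≤ t * (D.side v x * D.side v z) := mul_nonneg ht0 h4.le
  have h7 : 0 ≤ (1 - t) * D.side v x ^ 2 := mul_nonneg (by linarith) (sq_nonneg _)
  have hxne : D.side v x ≠ 0 := left_ne_zero_of_mul h4.ne'
  have h8 : t = 0 := by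
    have : t * (D.side v x * D.side v z) = 0 := by linarith
    exact (mul_eq_zero.mp this).resolve_right h4.ne'
  rw [h8] at h5
  simp at h5
  exact hxne h5

/-- The alternatives are cyclic shifts of one another, so that a single argument about the middle
point serves all three. -/
theorem mem_segment_or_of_mem_segment {p q x y z : ℂ} (hx : x ∈ segment ℝ p q)
    (hy : y ∈ segment ℝ p q) (hz : z ∈ segment ℝ p q) :
    y ∈ segment ℝ x z ∨ z ∈ segment ℝ y x ∨ x ∈ segment ℝ z y := by
  rw [segment_eq_image_lineMap] at hx hy hz
  obtain ⟨a, -, rfl⟩ := hx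
  obtain ⟨b, -, rfl⟩ := hy
  obtain ⟨c, -, rfl⟩ := hz
  have key : ∀ r s t : ℝ, s ∈ Set.uIcc r t → AffineMap.lineMap p q s ∈
      segment ℝ (AffineMap.lineMap p q r) (AffineMap.lineMap p q t : ℂ) := fun r s t h => by
    rw [← image_segment, segment_eq_uIcc]
    exact ⟨s, h, rfl⟩
  rcases le_total a b with h1 | h1 <;> rcases le_total b c with h2 | h2 <;>
    rcases le_total a c with h3 | h3
  all_goals first
    | exact Or.inl (key _ _ _ (by rw [Set.mem_uIcc]; tauto))
    | exact Or.inr (Or.inl (key _ _ _ (by rw [Set.mem_uIcc]; tauto)))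
    | exact Or.inr (Or.inr (key _ _ _ (by rw [Set.mem_uIcc]; tauto)))

/-- The graph of the cube, that is `K₄,₄` without a perfect matching, is not a circle graph. -/
theorem no_cube (a b : Fin 4 → V)
    (haa : ∀ i j, i ≠ j → ¬ (D.chord (a i) ∩ D.chord (a j)).Nonempty)
    (hab : ∀ i j, i ≠ j → (D.chord (a i) ∩ D.chord (b j)).Nonempty)
    (hne : ∀ i, ¬ (D.chord (a i) ∩ D.chord (b i)).Nonempty) : False := by
  obtain ⟨x, hx, hx'⟩ := hab 0 3 (by decide)
  obtain ⟨y, hy, hy'⟩ := hab 1 3 (by decide)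
  obtain ⟨z, hz, hz'⟩ := hab 2 3 (by decide)
  -- If `a j` is in the middle, `b j` meets the two outer chords and hence `a j`, contrary to `hne
  -- j`.
  have key : ∀ i j k : Fin 4, i ≠ j → k ≠ j → ∀ x y z : ℂ, x ∈ D.chord (a i) →
      y ∈ D.chord (a j) → z ∈ D.chord (a k) → y ∉ segment ℝ x z :=
    fun i j k hij hkj x y z hx hy hz h => hne j <|
      D.inter_nonempty_of_between (haa j i hij.symm) (haa j k hkj.symm) hx hy hz h
        (hab i j hij) (hab k j hkj)
  rcases mem_segment_or_of_mem_segment hx' hy' hz' with h | h | h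
  · exact key 0 1 2 (by decide) (by decide) x y z hx hy hz h
  · exact key 1 2 0 (by decide) (by decide) y z x hy hz hx h
  · exact key 2 0 1 (by decide) (by decide) z x y hz hx hy h

end ChordDiagram

/-! ### The hexagon as a circle graph -/

/-- The point of the unit circle with the given coordinates. -/
def circlePoint (x y : ℝ) (h : x ^ 2 + y ^ 2 = 1) : Circle :=
  ⟨⟨x, y⟩, by
    refine mem_sphere_zero_iff_norm.mpr ?_
    rw [← sq_eq_sq₀ (norm_nonneg _) zero_le_one, Complex.sq_norm, Complex.normSq_mk]
    linarith⟩

theorem circlePoint_inj {x y x' y' : ℝ} {h : x ^ 2 + y ^ 2 = 1} {h' : x' ^ 2 + y' ^ 2 = 1} :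
    circlePoint x y h = circlePoint x' y' h' ↔ x = x' ∧ y = y' := by
  rw [Circle.ext_iff]
  exact Complex.ext_iff

/-- Six chords that form the hexagon: each crosses the next one in the cyclic order. -/
noncomputable def hexagonDiagram : ChordDiagram (Fin 6) where
  -- Rational points from the 3-4-5 triangle turn injectivity and crossings into rational
  -- arithmetic.
  fst := ![circlePoint 1 0 (by norm_num), circlePoint (3 / 5) (4 / 5) (by norm_num),
    circlePoint (-3 / 5) (4 / 5) (by norm_num), circlePoint (-1) 0 (by norm_num),
    circlePoint (-3 / 5) (-4 / 5) (by norm_num), circlePoint (3 / 5) (-4 / 5) (by norm_num)]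
  snd := ![circlePoint 0 1 (by norm_num), circlePoint (-4 / 5) (3 / 5) (by norm_num),
    circlePoint (-4 / 5) (-3 / 5) (by norm_num), circlePoint 0 (-1) (by norm_num),
    circlePoint (4 / 5) (-3 / 5) (by norm_num), circlePoint (4 / 5) (3 / 5) (by norm_num)]
  endpoints_injective := by
    rintro (i | i) (j | j) h <;> fin_cases i <;> fin_cases j <;>
      simp [circlePoint_inj] at h ⊢ <;> norm_num at h

theorem isCircleGraph_cycleGraph_six : IsCircleGraph (SimpleGraph.cycleGraph 6) := by
  refine ⟨hexagonDiagram, ?_⟩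
  ext i j
  rw [ChordDiagram.intersectionGraph, SimpleGraph.cycleGraph_adj]
  simp only [ChordDiagram.chord_inter_chord_nonempty_iff]
  fin_cases i <;> fin_cases j <;>
    simp [ChordDiagram.side, lineSide, hexagonDiagram, circlePoint] <;> norm_num <;> try decide

/-! ### Radial projection and homotopies on wedges -/

section Direction

/-- The point of the unit circle in the direction of `w`. -/
noncomputable def circleDir (w : ℂ) : Circle := Circle.exp w.arg

theorem norm_mul_circleDir (w : ℂ) : (‖w‖ : ℂ) * circleDir w = w := by
  rw [circleDir, Circle.coe_exp]
  exact Complex.norm_mul_exp_arg_mul_I w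

theorem circleDir_coe (z : Circle) : circleDir z = z := Circle.exp_arg z

theorem circleDir_one : circleDir 1 = 1 := circleDir_coe 1

/-- The argument jumps along the negative axis; continuity is read off from w / ‖w‖ instead. -/
theorem Continuous.circleDir {X : Type*} [TopologicalSpace X] {f : X → ℂ} (hf : Continuous f)
    (h0 : ∀ x, f x ≠ 0) : Continuous fun x => circleDir (f x) := by
  have h : ∀ x, ((_root_.circleDir (f x) : Circle) : ℂ) = f x / ‖f x‖ := fun x => by
    rw [eq_div_iff (by simpa using h0 x), mul_comm, norm_mul_circleDir]
  exact continuous_induced_rng.mpr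
    ((hf.div (Complex.continuous_ofReal.comp hf.norm) (by simpa using h0)).congr
      fun x => (h x).symm)

/-- A self-map of the circle that fixes `1` and sends no point to its antipode is homotopic to the
identity through maps that fix `1`. -/
theorem exists_homotopy_id_of_ne_neg (τ : C(Circle, Circle)) (h1 : τ 1 = 1)
    (hτ : ∀ z : Circle, (τ z : ℂ) ≠ -z) :
    ∃ σ : C(Circle × unitInterval, Circle), (∀ s, σ (1, s) = 1) ∧ (∀ z, σ (z, 0) = τ z) ∧
      ∀ z, σ (z, 1) = z := by
  refine ⟨⟨fun p => circleDir ((1 - (p.2 : ℝ) : ℝ) * τ p.1 + (p.2 : ℝ) * p.1), ?_⟩, ?_, ?_, ?_⟩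
  · refine Continuous.circleDir (by fun_prop) fun p h => ?_
    -- If the segment from τ z to z hits 0, comparing norms puts the parameter at 1/2, so τ z = -z.
    have h2 : ((1 - (p.2 : ℝ) : ℝ) : ℂ) * τ p.1 = -((p.2 : ℝ) * p.1) := eq_neg_of_add_eq_zero_left h
    have h3 := congrArg norm h2
    rw [norm_neg, norm_mul, norm_mul, Circle.norm_coe, Circle.norm_coe, Complex.norm_real,
      Complex.norm_real, Real.norm_of_nonneg p.2.2.1,
      Real.norm_of_nonneg (by linarith [p.2.2.2])] at h3
    have h4 : (p.2 : ℝ) = 1 / 2 := by linarith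
    rw [h4] at h2
    apply hτ p.1
    have h5 : ((1 - 1 / 2 : ℝ) : ℂ) = 1 / 2 := by norm_num
    have h6 : ((1 / 2 : ℝ) : ℂ) = 1 / 2 := by norm_num
    rw [h5, h6] at h2
    linear_combination 2 * h2
  · intro s
    simp [h1, circleDir_one]
  · intro z
    simp [circleDir_coe]
  · intro z
    simp [circleDir_coe]

end Direction

section WedgeHomotopy

variable {X Y Z : Type*} [TopologicalSpace X] [TopologicalSpace Y] [TopologicalSpace Z]

/-- Two maps from a wedge are homotopic if their restrictions are, through homotopies that agree at
the base point. -/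
theorem homotopic_of_wedge {x₀ : X} {y₀ : Y} (f g : C(WedgeSum x₀ y₀, Z))
    (H₁ : C(X × unitInterval, Z)) (H₂ : C(Y × unitInterval, Z))
    (h : ∀ s, H₁ (x₀, s) = H₂ (y₀, s))
    (hf₁ : ∀ x, H₁ (x, 0) = f (Quot.mk _ (Sum.inl x)))
    (hg₁ : ∀ x, H₁ (x, 1) = g (Quot.mk _ (Sum.inl x)))
    (hf₂ : ∀ y, H₂ (y, 0) = f (Quot.mk _ (Sum.inr y)))
    (hg₂ : ∀ y, H₂ (y, 1) = g (Quot.mk _ (Sum.inr y))) : f.Homotopic g := by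
  -- Currying lets the homotopy descend to the quotient without asking whether its product with the
  -- interval is a quotient.
  let Φ : C(WedgeSum x₀ y₀, C(unitInterval, Z)) :=
    ⟨Quot.lift (Sum.elim H₁.curry H₂.curry) (by
      rintro _ _ ⟨⟩
      ext s
      exact h s), continuous_quot_lift _ (by fun_prop)⟩
  refine ⟨⟨Φ.uncurry.comp ⟨Prod.swap, continuous_swap⟩, ?_, ?_⟩⟩
  · rintro ⟨x | y⟩
    exacts [hf₁ x, hf₂ y]
  · rintro ⟨x | y⟩
    exacts [hg₁ x, hg₂ y]

end WedgeHomotopy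

/-- Two maps into the independence complex are homotopic if at each point the union of the supports
of their values is independent. -/
theorem homotopic_of_forall_adj {V Y : Type*} [Fintype V] [TopologicalSpace Y] {G : SimpleGraph V}
    (f g : C(Y, geometricRealization (independenceComplex G)))
    (h : ∀ y u v, G.Adj u v → (f y).1 u * (g y).1 v = 0) : f.Homotopic g := by
  classical
  refine homotopic_of_contiguous f g fun y => ?_
  obtain ⟨s, hs, hfs⟩ := (f y).2.2
  obtain ⟨t, ht, hgt⟩ := (g y).2.2
  refine ⟨Finset.univ.filter fun v => (f y).1 v ≠ 0 ∨ (g y).1 v ≠ 0, ⟨?_, ?_⟩, ?_, ?_⟩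
  · obtain ⟨v, -, hv⟩ := Finset.exists_ne_zero_of_sum_ne_zero
      (by rw [(f y).2.1.2]; exact one_ne_zero : ∑ v, (f y).1 v ≠ 0)
    exact ⟨v, by simp [hv]⟩
  · intro u hu v hv huv hadj
    simp only [Finset.coe_filter, Finset.mem_univ, true_and, Set.mem_ofPred_eq] at hu hv
    rcases hu with hu | hu <;> rcases hv with hv | hv
    · exact hs.2 (hfs u hu) (hfs v hv) huv hadj
    · exact (mul_ne_zero hu hv) (h y u v hadj)
    · exact (mul_ne_zero hv hu) (h y v u hadj.symm)
    · exact ht.2 (hgt u hu) (hgt v hv) huv hadj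
  · intro v hv; simp [hv]
  · intro v hv; simp [hv]

/-! ### Simplices of the hexagon complex -/

section Hexagon

open SimpleGraph

theorem isBipartite_cycleGraph_six : (cycleGraph 6).IsBipartite :=
  ⟨Coloring.mk (fun v => ![0, 1, 0, 1, 0, 1] v) (by
    simp only [cycleGraph_adj]; decide)⟩

theorem mem_realization_hexagon_iff {x : Fin 6 → ℝ} :
    x ∈ geometricRealization (independenceComplex (cycleGraph 6)) ↔
      (∀ v, 0 ≤ x v) ∧ x 0 + x 1 + x 2 + x 3 + x 4 + x 5 = 1 ∧
        x 0 * x 1 = 0 ∧ x 1 * x 2 = 0 ∧ x 2 * x 3 = 0 ∧ x 3 * x 4 = 0 ∧ x 4 * x 5 = 0 ∧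
        x 5 * x 0 = 0 := by
  constructor
  · rintro ⟨⟨h0, h1⟩, s, hs, hxs⟩
    have key : ∀ u v, (cycleGraph 6).Adj u v → x u * x v = 0 := fun u v huv => by
      by_contra h
      exact hs.2 (hxs u (left_ne_zero_of_mul h)) (hxs v (right_ne_zero_of_mul h)) huv.ne huv
    rw [Fin.sum_univ_six] at h1
    refine ⟨h0, h1, ?_, ?_, ?_, ?_, ?_, ?_⟩ <;> exact key _ _ (by rw [cycleGraph_adj]; decide)
  · rintro ⟨h0, h1, h⟩
    have h1' : ∑ v, x v = 1 := by rw [Fin.sum_univ_six, h1]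
    refine ⟨⟨h0, h1'⟩, Finset.univ.filter fun v => x v ≠ 0, ⟨?_, ?_⟩, fun v hv => by simpa using hv⟩
    · obtain ⟨v, -, hv⟩ := Finset.exists_ne_zero_of_sum_ne_zero
        (by rw [h1']; exact one_ne_zero : ∑ v, x v ≠ 0)
      exact ⟨v, by simp [hv]⟩
    · have key : ∀ u v, (cycleGraph 6).Adj u v → x u * x v = 0 := by
        intro u v huv
        rw [cycleGraph_adj] at huv
        revert huv
        fin_cases u <;> fin_cases v <;> intro huv <;>
          first | exact absurd huv (by decide) | (simp at h ⊢; tauto)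
      intro u hu v hv _ hadj
      simp only [Finset.coe_filter, Finset.mem_univ, true_and, Set.mem_ofPred_eq] at hu hv
      exact mul_ne_zero hu hv (key u v hadj)

/-- The cases are the maximal simplices: the odd and even vanishing patterns give the two triangles,
the others the edges 0-3, 2-5 and 1-4. -/
theorem hexagon_cases {x : Fin 6 → ℝ}
    (hx : x ∈ geometricRealization (independenceComplex (cycleGraph 6))) :
    (x 1 = 0 ∧ x 3 = 0 ∧ x 5 = 0) ∨ (x 0 = 0 ∧ x 2 = 0 ∧ x 4 = 0) ∨
      (x 1 = 0 ∧ x 2 = 0 ∧ x 4 = 0 ∧ x 5 = 0) ∨ (x 0 = 0 ∧ x 1 = 0 ∧ x 3 = 0 ∧ x 4 = 0) ∨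
      (x 0 = 0 ∧ x 2 = 0 ∧ x 3 = 0 ∧ x 5 = 0) := by
  obtain ⟨-, -, h⟩ := mem_realization_hexagon_iff.mp hx
  simp only [mul_eq_zero] at h
  tauto

end Hexagon

/-! ### Piecewise-linear formulas for the hexagon complex -/

section HexagonCoordinates

/-- The progress of a point along one of the two cycles of the hexagon complex: `a` and `b` are the
weights of the vertices of the cycle off the base edge, `s` and `t` the weights of their triangles. -/
def progress (a b s t : ℝ) : ℝ := max 0 (2 * a - s) + max 0 (2 * b - t)

/-- The map that wraps a cycle of the hexagon complex around the boundary of a square, and collapses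
its base edge. -/
def wrap (c t : ℝ) : ℂ := ⟨min 1 (3 - 4 * c), (1 - 2 * t) * min 1 (2 * c)⟩

/-- The amount by which `4 a` exceeds `3 s`. -/
def excess (a s : ℝ) : ℝ := max 0 (4 * a - 3 * s)

theorem wrap_zero (t : ℝ) : wrap 0 t = 1 := by
  apply Complex.ext <;> simp [wrap]

/-- The barycentric coordinates of a point of the independence complex of the hexagon: `aᵢ` and `bᵢ`
belong to opposite vertices, `s` and `t` are the weights of the two triangles. -/
structure HexagonCoords (a₀ a₁ a₂ b₀ b₁ b₂ s t : ℝ) : Prop where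
  a₀_nonneg : 0 ≤ a₀
  a₁_nonneg : 0 ≤ a₁
  a₂_nonneg : 0 ≤ a₂
  b₀_nonneg : 0 ≤ b₀
  b₁_nonneg : 0 ≤ b₁
  b₂_nonneg : 0 ≤ b₂
  sum_a : a₀ + a₁ + a₂ = s
  sum_b : b₀ + b₁ + b₂ = t
  sum : s + t = 1
  cases : (b₀ = 0 ∧ b₁ = 0 ∧ b₂ = 0) ∨ (a₀ = 0 ∧ a₁ = 0 ∧ a₂ = 0) ∨
    (a₁ = 0 ∧ a₂ = 0 ∧ b₁ = 0 ∧ b₂ = 0) ∨ (a₀ = 0 ∧ a₂ = 0 ∧ b₀ = 0 ∧ b₂ = 0) ∨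
    (a₀ = 0 ∧ a₁ = 0 ∧ b₀ = 0 ∧ b₁ = 0)

namespace HexagonCoords

variable {a₀ a₁ a₂ b₀ b₁ b₂ s t : ℝ}

theorem swap (h : HexagonCoords a₀ a₁ a₂ b₀ b₁ b₂ s t) :
    HexagonCoords a₀ a₂ a₁ b₀ b₂ b₁ s t := by
  obtain ⟨ha₀, ha₁, ha₂, hb₀, hb₁, hb₂, hs, ht, hst, h⟩ := h
  exact ⟨ha₀, ha₂, ha₁, hb₀, hb₂, hb₁, by linarith, by linarith, hst, by tauto⟩

theorem congr_sum (h : HexagonCoords a₀ a₁ a₂ b₀ b₁ b₂ s t) :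
    HexagonCoords a₀ a₁ a₂ b₀ b₁ b₂ (a₀ + a₁ + a₂) (b₀ + b₁ + b₂) := by
  rw [h.sum_a, h.sum_b]
  exact h

/-- Two vertices of one triangle cannot both carry more than half of its weight, and a₁, b₂
(likewise a₂, b₁) never lie in a common simplex. -/
theorem progress_eq_zero_or_eq_zero (h : HexagonCoords a₀ a₁ a₂ b₀ b₁ b₂ s t) :
    progress a₁ b₁ s t = 0 ∨ progress a₂ b₂ s t = 0 := by
  obtain ⟨ha₀, ha₁, ha₂, hb₀, hb₁, hb₂, hs, ht, hst, h⟩ := h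
  unfold progress
  grind

/-- The real part vanishes only at progress 3/4. The connecting edges have progress 0 or 1, so such
a point lies in a triangle, where t is 0 or 1 and the imaginary part is ±1. -/
theorem wrap_ne_zero (h : HexagonCoords a₀ a₁ a₂ b₀ b₁ b₂ s t) :
    wrap (progress a₁ b₁ s t) t ≠ 0 := by
  obtain ⟨ha₀, ha₁, ha₂, hb₀, hb₁, hb₂, hs, ht, hst, h⟩ := h
  intro h0
  have h1 := congrArg Complex.re h0
  have h2 := congrArg Complex.im h0
  simp only [wrap, progress, Complex.zero_re, Complex.zero_im, mul_eq_zero] at h1 h2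
  grind

/-- A point and its contraction share a maximal simplex: `excess a s` is 0 when a = 0 and s when a =
s, so the three connecting edges stay fixed and each triangle is preserved. -/
theorem cases_contract (h : HexagonCoords a₀ a₁ a₂ b₀ b₁ b₂ s t) :
    (b₀ = 0 ∧ b₁ = 0 ∧ b₂ = 0 ∧ t - excess b₁ t - excess b₂ t = 0 ∧ excess b₁ t = 0 ∧
      excess b₂ t = 0) ∨
    (a₀ = 0 ∧ a₁ = 0 ∧ a₂ = 0 ∧ s - excess a₁ s - excess a₂ s = 0 ∧ excess a₁ s = 0 ∧
      excess a₂ s = 0) ∨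
    (a₁ = 0 ∧ a₂ = 0 ∧ b₁ = 0 ∧ b₂ = 0 ∧ excess a₁ s = 0 ∧ excess a₂ s = 0 ∧ excess b₁ t = 0 ∧
      excess b₂ t = 0) ∨
    (a₀ = 0 ∧ a₂ = 0 ∧ b₀ = 0 ∧ b₂ = 0 ∧ s - excess a₁ s - excess a₂ s = 0 ∧ excess a₂ s = 0 ∧
      t - excess b₁ t - excess b₂ t = 0 ∧ excess b₂ t = 0) ∨
    (a₀ = 0 ∧ a₁ = 0 ∧ b₀ = 0 ∧ b₁ = 0 ∧ s - excess a₁ s - excess a₂ s = 0 ∧ excess a₁ s = 0 ∧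
      t - excess b₁ t - excess b₂ t = 0 ∧ excess b₁ t = 0) := by
  obtain ⟨ha₀, ha₁, ha₂, hb₀, hb₁, hb₂, hs, ht, hst, h⟩ := h
  unfold excess
  rcases h with h | h | h | h | h
  · exact Or.inl (by grind)
  · exact Or.inr (Or.inl (by grind))
  · exact Or.inr (Or.inr (Or.inl (by grind)))
  · exact Or.inr (Or.inr (Or.inr (Or.inl (by grind))))
  · exact Or.inr (Or.inr (Or.inr (Or.inr (by grind))))

theorem contract (h : HexagonCoords a₀ a₁ a₂ b₀ b₁ b₂ s t) :
    HexagonCoords (s - excess a₁ s - excess a₂ s) (excess a₁ s) (excess a₂ s)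
      (t - excess b₁ t - excess b₂ t) (excess b₁ t) (excess b₂ t) s t := by
  have hc := h.cases_contract
  obtain ⟨ha₀, ha₁, ha₂, hb₀, hb₁, hb₂, hs, ht, hst, h⟩ := h
  refine ⟨?_, le_max_left _ _, le_max_left _ _, ?_, le_max_left _ _, le_max_left _ _, by ring,
    by ring, hst, by tauto⟩
  · unfold excess
    grind
  · unfold excess
    grind

/-- For (X, Y) on the square, the four sign conditions say that the left cycle uses vertex 0, 2, 3
or 5; each conclusion says that the contraction avoids its two neighbours in the hexagon. The
constants match: in a triangle, `excess` becomes positive at weight 3/4, that is at progress 1/2,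
where `wrap` turns the corner off the right side. -/
theorem wrap_contiguous (h : HexagonCoords a₀ a₁ a₂ b₀ b₁ b₂ s t)
    (hle : progress a₂ b₂ s t ≤ progress a₁ b₁ s t) {X Y : ℝ}
    (hX : (wrap (progress a₁ b₁ s t) t).re = X) (hY : (wrap (progress a₁ b₁ s t) t).im = Y) :
    (0 < X + Y → excess b₁ t = 0 ∧ excess b₂ t = 0) ∧
    (0 < Y - X → t - excess b₁ t - excess b₂ t = 0 ∧ excess b₂ t = 0) ∧
    (0 < X - Y → excess a₁ s = 0 ∧ excess a₂ s = 0) ∧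
    (0 < -X - Y → s - excess a₁ s - excess a₂ s = 0 ∧ excess a₂ s = 0) := by
  obtain ⟨ha₀, ha₁, ha₂, hb₀, hb₁, hb₂, rfl, rfl, hst, h⟩ := h
  simp only [wrap] at hX hY
  unfold excess
  unfold progress at *
  rcases h with ⟨rfl, rfl, rfl⟩ | ⟨rfl, rfl, rfl⟩ | ⟨rfl, rfl, rfl, rfl⟩ | ⟨rfl, rfl, rfl, rfl⟩ |
    ⟨rfl, rfl, rfl, rfl⟩
  · grind
  · have hT : b₀ + b₁ + b₂ = 1 := by linarith
    rw [hT] at hle hX hY ⊢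
    grind
  · have hc : max 0 (2 * 0 - (a₀ + 0 + 0)) + max 0 (2 * 0 - (b₀ + 0 + 0)) = 0 := by grind
    rw [hc] at hX hY
    norm_num at hX hY
    grind
  · have hc : max 0 (2 * a₁ - (0 + a₁ + 0)) + max 0 (2 * b₁ - (0 + b₁ + 0)) = 1 := by grind
    rw [hc] at hX hY
    norm_num at hX hY
    grind
  -- On the edge a₂b₂ the second progress is 1 and the first is 0, against `hle`.
  · exfalso
    clear hX hY
    grind

end HexagonCoords

/-- The share of the positive part of `u` in `|u| + |v|`. -/
noncomputable def posShare (u v : ℝ) : ℝ := max 0 u / (|u| + |v|)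

theorem posShare_smul {r : ℝ} (hr : 0 < r) (u v : ℝ) : posShare (r * u) (r * v) = posShare u v := by
  have h : max 0 (r * u) = r * max 0 u := by rw [mul_max_of_nonneg _ _ hr.le, mul_zero]
  rw [posShare, posShare, abs_mul, abs_mul, abs_of_pos hr, ← mul_add, h,
    mul_div_mul_left _ _ hr.ne']

theorem posShare_nonneg (u v : ℝ) : 0 ≤ posShare u v :=
  div_nonneg (le_max_left _ _) (by positivity)

theorem pos_of_posShare_ne_zero {u v : ℝ} (h : posShare u v ≠ 0) : 0 < u := by
  by_contra hu
  exact h (by rw [posShare, max_eq_left (not_lt.mp hu), zero_div])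

/-- The boundary of the square with vertices `1 ± i` and `-1 ± i`, in barycentric coordinates. -/
theorem hexagonCoords_square {x y : ℝ} (h : x ≠ 0 ∨ y ≠ 0) :
    HexagonCoords (posShare (x + y) (x - y)) (posShare (y - x) (x + y)) 0
      (posShare (x - y) (x + y)) (posShare (-x - y) (x - y)) 0
      (posShare (x + y) (x - y) + posShare (y - x) (x + y))
      (posShare (x - y) (x + y) + posShare (-x - y) (x - y)) := by
  have hn : 0 < |x + y| + |x - y| := by
    rcases h with h | h <;> grind
  refine ⟨posShare_nonneg _ _, posShare_nonneg _ _, le_rfl, posShare_nonneg _ _,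
    posShare_nonneg _ _, le_rfl, by ring, by ring, ?_, ?_⟩
  · simp only [posShare]
    rw [abs_sub_comm y x, show |-x - y| = |x + y| by rw [← abs_neg]; ring_nf,
      add_comm |x - y|, ← add_div, ← add_div, ← add_div, div_eq_one_iff_eq hn.ne']
    grind
  -- Opposite corners of the square never both receive weight, so the support is a vertex or a side.
  · have h1 : x + y ≤ 0 ∨ -x - y ≤ 0 := by
      rcases le_total (x + y) 0 with h | h
      exacts [Or.inl h, Or.inr (by linarith)]
    have h2 : x - y ≤ 0 ∨ y - x ≤ 0 := by
      rcases le_total (x - y) 0 with h | h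
      exacts [Or.inl h, Or.inr (by linarith)]
    have key : ∀ {u v : ℝ}, u ≤ 0 → posShare u v = 0 := fun hu => by
      rw [posShare, max_eq_left hu, zero_div]
    rcases h1 with h1 | h1 <;> rcases h2 with h2 | h2 <;> simp [key h1, key h2]

/-- The self-map of the circle that is induced by `wrap` sends no point to its antipode. -/
theorem wrap_square_ne {x y r : ℝ} (hxy : x ^ 2 + y ^ 2 = 1) (hr : 0 < r) {a₀ a₁ b₀ b₁ : ℝ}
    (ha₀ : a₀ = posShare (x + y) (x - y)) (ha₁ : a₁ = posShare (y - x) (x + y))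
    (hb₀ : b₀ = posShare (x - y) (x + y)) (hb₁ : b₁ = posShare (-x - y) (x - y))
    (hre : (wrap (progress a₁ b₁ (a₀ + a₁) (b₀ + b₁)) (b₀ + b₁)).re = -(r * x))
    (him : (wrap (progress a₁ b₁ (a₀ + a₁) (b₀ + b₁)) (b₀ + b₁)).im = -(r * y)) : False := by
  have hne : x ≠ 0 ∨ y ≠ 0 := by
    by_contra! h
    rw [h.1, h.2] at hxy
    norm_num at hxy
  have hn : 0 < |x + y| + |x - y| := by
    rcases hne with h | h <;> grind
  have hsum := (hexagonCoords_square hne).sum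
  rw [← ha₀, ← ha₁, ← hb₀, ← hb₁] at hsum
  -- The imaginary part of `wrap` is a nonnegative multiple of 1 - 2t, which has the sign of y; an
  -- antipodal value therefore forces y = 0 and leaves only x = ±1.
  have hT : (1 - 2 * (b₀ + b₁)) * (|x + y| + |x - y|) = 2 * y := by
    have h1 : 1 - 2 * (b₀ + b₁) = (a₀ + a₁) - (b₀ + b₁) := by linarith
    rw [h1, ha₀, ha₁, hb₀, hb₁]
    simp only [posShare]
    rw [abs_sub_comm y x, show |-x - y| = |x + y| by rw [← abs_neg]; ring_nf,
      add_comm |x - y|]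
    field_simp
    grind
  have hC : 0 ≤ progress a₁ b₁ (a₀ + a₁) (b₀ + b₁) := add_nonneg (le_max_left _ _) (le_max_left _ _)
  simp only [wrap] at hre him
  have hy : y = 0 := by
    have hm : 0 ≤ min 1 (2 * progress a₁ b₁ (a₀ + a₁) (b₀ + b₁)) := le_min zero_le_one (by linarith)
    have h2 : -(r * y) * (|x + y| + |x - y|) =
        2 * y * min 1 (2 * progress a₁ b₁ (a₀ + a₁) (b₀ + b₁)) := by
      rw [← him, ← hT]; ring
    have h3 : y ^ 2 * (r * (|x + y| + |x - y|) +
        2 * min 1 (2 * progress a₁ b₁ (a₀ + a₁) (b₀ + b₁))) = 0 := by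
      linear_combination (-y) * h2
    rcases mul_eq_zero.mp h3 with h | h
    · exact pow_eq_zero_iff (two_ne_zero) |>.mp h
    · have := mul_pos hr hn
      linarith
  subst hy
  have hx : x = 1 ∨ x = -1 := by
    exact sq_eq_one_iff.mp (by linarith)
  rcases hx with rfl | rfl
  · norm_num [posShare] at ha₀ ha₁ hb₀ hb₁
    subst ha₀ ha₁ hb₀ hb₁
    norm_num [progress] at hre
    linarith
  · norm_num [posShare] at ha₀ ha₁ hb₀ hb₁
    subst ha₀ ha₁ hb₀ hb₁
    norm_num [progress] at hre
    linarith

end HexagonCoordinates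

/-! ### The hexagon complex and the wedge of two circles -/

section HexagonHomotopyEquivalence

open SimpleGraph

local notation "HexagonComplex" => geometricRealization (independenceComplex (cycleGraph 6))

theorem forall_adj_hexagon {P : Fin 6 → Fin 6 → Prop}
    (h : ((P 0 1 ∧ P 0 5) ∧ (P 2 1 ∧ P 2 3) ∧ (P 4 3 ∧ P 4 5)) ∧
      (P 1 0 ∧ P 1 2) ∧ (P 3 2 ∧ P 3 4) ∧ (P 5 4 ∧ P 5 0)) :
    ∀ u v, (cycleGraph 6).Adj u v → P u v := by
  intro u v huv
  rw [cycleGraph_adj] at huv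
  revert huv
  fin_cases u <;> fin_cases v <;> intro huv <;>
    first | exact absurd huv (by decide) | (simp at h ⊢; tauto)

theorem mem_realization_iff_hexagonCoords {x : Fin 6 → ℝ} : x ∈ HexagonComplex ↔
    HexagonCoords (x 0) (x 2) (x 4) (x 3) (x 5) (x 1) (x 0 + x 2 + x 4) (x 3 + x 5 + x 1) := by
  constructor
  · intro hx
    obtain ⟨h0, h1, -⟩ := mem_realization_hexagon_iff.mp hx
    have := hexagon_cases hx
    exact ⟨h0 _, h0 _, h0 _, h0 _, h0 _, h0 _, rfl, rfl, by linarith, by tauto⟩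
  · intro h
    obtain ⟨ha₀, ha₁, ha₂, hb₀, hb₁, hb₂, -, -, hst, h⟩ := h
    refine mem_realization_hexagon_iff.mpr ⟨fun v => by fin_cases v <;> assumption, by linarith, ?_⟩
    simp only [mul_eq_zero]
    tauto

variable (x : HexagonComplex)

/-- The weight of the triangle of even vertices. -/
def evenWeight (x : Fin 6 → ℝ) : ℝ := x 0 + x 2 + x 4

/-- The weight of the triangle of odd vertices. -/
def oddWeight (x : Fin 6 → ℝ) : ℝ := x 3 + x 5 + x 1

theorem hexagonCoords : HexagonCoords (x.1 0) (x.1 2) (x.1 4) (x.1 3) (x.1 5) (x.1 1)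
    (evenWeight x.1) (oddWeight x.1) := mem_realization_iff_hexagonCoords.mp x.2

@[fun_prop]
theorem continuous_evenWeight : Continuous evenWeight := by unfold evenWeight; fun_prop

@[fun_prop]
theorem continuous_oddWeight : Continuous oddWeight := by unfold oddWeight; fun_prop

/-- The progress along the cycle through the vertices `0`, `2`, `5`, `3`. -/
def progressLeft (x : Fin 6 → ℝ) : ℝ := progress (x 2) (x 5) (evenWeight x) (oddWeight x)

/-- The progress along the cycle through the vertices `0`, `4`, `1`, `3`. -/
def progressRight (x : Fin 6 → ℝ) : ℝ := progress (x 4) (x 1) (evenWeight x) (oddWeight x)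

theorem continuous_progressLeft : Continuous progressLeft := by
  unfold progressLeft progress; fun_prop

theorem continuous_progressRight : Continuous progressRight := by
  unfold progressRight progress; fun_prop

theorem continuous_wrap {X : Type*} [TopologicalSpace X] {c t : X → ℝ} (hc : Continuous c)
    (ht : Continuous t) : Continuous fun x => wrap (c x) (t x) := by
  have : ∀ x, wrap (c x) (t x) = (min 1 (3 - 4 * c x) : ℝ) +
      ((1 - 2 * t x) * min 1 (2 * c x) : ℝ) * Complex.I := fun x => by
    rw [wrap, ← Complex.mk_eq_add_mul_I]
  simp only [this]
  fun_prop

theorem continuous_excess {X : Type*} [TopologicalSpace X] {a s : X → ℝ} (ha : Continuous a)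
    (hs : Continuous s) : Continuous fun x => excess (a x) (s x) := by
  unfold excess; fun_prop

/-- The deformation of the hexagon complex that pushes the two triangles towards the base edge. -/
noncomputable def hexagonContract : C(HexagonComplex, HexagonComplex) where
  toFun x := ⟨![evenWeight x.1 - excess (x.1 2) (evenWeight x.1) - excess (x.1 4) (evenWeight x.1),
    excess (x.1 1) (oddWeight x.1), excess (x.1 2) (evenWeight x.1),
    oddWeight x.1 - excess (x.1 5) (oddWeight x.1) - excess (x.1 1) (oddWeight x.1),
    excess (x.1 4) (evenWeight x.1), excess (x.1 5) (oddWeight x.1)], by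
      exact mem_realization_iff_hexagonCoords.mpr (hexagonCoords x).contract.congr_sum⟩
  continuous_toFun := by
    have hc : ∀ i, Continuous fun x : HexagonComplex => x.1 i :=
      fun i => (continuous_apply i).comp continuous_subtype_val
    have hs : Continuous fun x : HexagonComplex => evenWeight x.1 :=
      continuous_evenWeight.comp continuous_subtype_val
    have ht : Continuous fun x : HexagonComplex => oddWeight x.1 :=
      continuous_oddWeight.comp continuous_subtype_val
    have hes := fun i => continuous_excess (hc i) hs
    have het := fun i => continuous_excess (hc i) ht
    refine Continuous.subtype_mk (continuous_pi fun v => ?_) _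
    fin_cases v
    exacts [(hs.sub (hes 2)).sub (hes 4), het 1, hes 2, (ht.sub (het 5)).sub (het 1), hes 4, het 5]

/-- The collapse of the base edge and of the two triangles onto the base point of a wedge of two
circles. -/
noncomputable def hexagonCollapse : C(HexagonComplex, WedgeSum (1 : Circle) (1 : Circle)) where
  toFun x := if progressRight x.1 ≤ progressLeft x.1
    then Quot.mk _ (Sum.inl (circleDir (wrap (progressLeft x.1) (oddWeight x.1))))
    else Quot.mk _ (Sum.inr (circleDir (wrap (progressRight x.1) (oddWeight x.1))))
  continuous_toFun := by
    refine Continuous.if_le ?_ ?_ (continuous_progressRight.comp continuous_subtype_val)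
      (continuous_progressLeft.comp continuous_subtype_val) fun x hx => ?_
    · exact continuous_quot_mk.comp (continuous_inl.comp (Continuous.circleDir (continuous_wrap
        (continuous_progressLeft.comp continuous_subtype_val)
        (continuous_oddWeight.comp continuous_subtype_val))
        fun x => (hexagonCoords x).wrap_ne_zero))
    · exact continuous_quot_mk.comp (continuous_inr.comp (Continuous.circleDir (continuous_wrap
        (continuous_progressRight.comp continuous_subtype_val)
        (continuous_oddWeight.comp continuous_subtype_val))
        fun x => (hexagonCoords x).swap.wrap_ne_zero))
    · have h0 : progressLeft x.1 = 0 ∧ progressRight x.1 = 0 := by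
        rcases (hexagonCoords x).progress_eq_zero_or_eq_zero with h | h
        · exact ⟨h, hx.trans h⟩
        · exact ⟨hx.symm.trans h, h⟩
      rw [h0.1, h0.2, wrap_zero, circleDir_one]
      exact Quot.sound WedgeRel.glue

/-- The cycle through the vertices `0`, `2`, `5`, `3`, parametrized by directions. -/
noncomputable def leftCycle (w : ℂ) : Fin 6 → ℝ :=
  ![posShare (w.re + w.im) (w.re - w.im), 0, posShare (w.im - w.re) (w.re + w.im),
    posShare (w.re - w.im) (w.re + w.im), 0, posShare (-w.re - w.im) (w.re - w.im)]

/-- The cycle through the vertices `0`, `4`, `1`, `3`, parametrized by directions. -/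
noncomputable def rightCycle (w : ℂ) : Fin 6 → ℝ :=
  ![posShare (w.re + w.im) (w.re - w.im), posShare (-w.re - w.im) (w.re - w.im), 0,
    posShare (w.re - w.im) (w.re + w.im), posShare (w.im - w.re) (w.re + w.im), 0]

theorem re_ne_zero_or_im_ne_zero {w : ℂ} (h : w ≠ 0) : w.re ≠ 0 ∨ w.im ≠ 0 := by
  by_contra! h'
  exact h (Complex.ext h'.1 h'.2)

theorem leftCycle_mem {w : ℂ} (h : w ≠ 0) : leftCycle w ∈ HexagonComplex := by
  refine mem_realization_iff_hexagonCoords.mpr ?_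
  simpa [leftCycle] using hexagonCoords_square (re_ne_zero_or_im_ne_zero h)

theorem rightCycle_mem {w : ℂ} (h : w ≠ 0) : rightCycle w ∈ HexagonComplex := by
  refine mem_realization_iff_hexagonCoords.mpr ?_
  simpa [rightCycle] using (hexagonCoords_square (re_ne_zero_or_im_ne_zero h)).swap

theorem exists_pos_mul_circleDir {w : ℂ} (h : w ≠ 0) : ∃ r : ℝ, 0 < r ∧
    w.re = r * (circleDir w : ℂ).re ∧ w.im = r * (circleDir w : ℂ).im := by
  refine ⟨‖w‖, norm_pos_iff.mpr h, ?_, ?_⟩ <;>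
    conv_lhs => rw [← norm_mul_circleDir w]
  · rw [Complex.re_ofReal_mul]
  · rw [Complex.im_ofReal_mul]

theorem posShare_circleDir_square {w : ℂ} (h : w ≠ 0) :
    posShare ((circleDir w : ℂ).re + (circleDir w : ℂ).im)
        ((circleDir w : ℂ).re - (circleDir w : ℂ).im) = posShare (w.re + w.im) (w.re - w.im) ∧
      posShare ((circleDir w : ℂ).im - (circleDir w : ℂ).re)
        ((circleDir w : ℂ).re + (circleDir w : ℂ).im) = posShare (w.im - w.re) (w.re + w.im) ∧
      posShare ((circleDir w : ℂ).re - (circleDir w : ℂ).im)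
        ((circleDir w : ℂ).re + (circleDir w : ℂ).im) = posShare (w.re - w.im) (w.re + w.im) ∧
      posShare (-(circleDir w : ℂ).re - (circleDir w : ℂ).im)
        ((circleDir w : ℂ).re - (circleDir w : ℂ).im) = posShare (-w.re - w.im) (w.re - w.im) := by
  obtain ⟨r, hr, h1, h2⟩ := exists_pos_mul_circleDir h
  rw [h1, h2]
  refine ⟨?_, ?_, ?_, ?_⟩ <;> rw [← posShare_smul hr] <;> congr 1 <;> ring

theorem leftCycle_circleDir {w : ℂ} (h : w ≠ 0) : leftCycle (circleDir w) = leftCycle w := by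
  obtain ⟨h1, h2, h3, h4⟩ := posShare_circleDir_square h
  simp only [leftCycle, h1, h2, h3, h4]

theorem rightCycle_circleDir {w : ℂ} (h : w ≠ 0) : rightCycle (circleDir w) = rightCycle w := by
  obtain ⟨h1, h2, h3, h4⟩ := posShare_circleDir_square h
  simp only [rightCycle, h1, h2, h3, h4]

theorem continuous_posShare {X : Type*} [TopologicalSpace X] {u v : X → ℝ} (hu : Continuous u)
    (hv : Continuous v) (h : ∀ x, u x ≠ 0 ∨ v x ≠ 0) :
    Continuous fun x => posShare (u x) (v x) := by
  unfold posShare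
  refine Continuous.div (by fun_prop) (by fun_prop) fun x => ?_
  rcases h x with h | h <;> positivity

theorem continuous_posShare_square :
    (Continuous fun z : Circle => posShare ((z : ℂ).re + (z : ℂ).im) ((z : ℂ).re - (z : ℂ).im)) ∧
    (Continuous fun z : Circle => posShare ((z : ℂ).im - (z : ℂ).re) ((z : ℂ).re + (z : ℂ).im)) ∧
    (Continuous fun z : Circle => posShare ((z : ℂ).re - (z : ℂ).im) ((z : ℂ).re + (z : ℂ).im)) ∧
    Continuous fun z : Circle =>
      posShare (-(z : ℂ).re - (z : ℂ).im) ((z : ℂ).re - (z : ℂ).im) := by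
  have h : ∀ z : Circle, (z : ℂ).re ≠ 0 ∨ (z : ℂ).im ≠ 0 :=
    fun z => re_ne_zero_or_im_ne_zero z.coe_ne_zero
  have hre : Continuous fun z : Circle => (z : ℂ).re := by fun_prop
  have him : Continuous fun z : Circle => (z : ℂ).im := by fun_prop
  refine ⟨?_, ?_, ?_, ?_⟩ <;>
    refine continuous_posShare (by fun_prop) (by fun_prop) fun z => ?_ <;>
    rcases h z with h | h <;> grind

/-- The map from a wedge of two circles to the hexagon complex that goes along the two cycles. -/
noncomputable def hexagonCycles : C(WedgeSum (1 : Circle) (1 : Circle), HexagonComplex) where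
  toFun := Quot.lift (Sum.elim (fun z => ⟨leftCycle z, leftCycle_mem z.coe_ne_zero⟩)
    fun z => ⟨rightCycle z, rightCycle_mem z.coe_ne_zero⟩) (by
      rintro _ _ ⟨⟩
      ext v
      fin_cases v <;> simp [leftCycle, rightCycle, posShare])
  continuous_toFun := by
    obtain ⟨h1, h2, h3, h4⟩ := continuous_posShare_square
    refine continuous_quot_lift _ (continuous_sumElim.mpr ⟨?_, ?_⟩) <;>
      refine Continuous.subtype_mk (continuous_pi fun v => ?_) _ <;>
      fin_cases v <;> simp only [leftCycle, rightCycle] <;>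
      first | exact h1 | exact h2 | exact h3 | exact h4 | exact continuous_const

theorem id_homotopic_hexagonContract :
    (ContinuousMap.id HexagonComplex).Homotopic hexagonContract := by
  refine homotopic_of_forall_adj _ _ fun x => forall_adj_hexagon ?_
  have := (hexagonCoords x).cases_contract
  simp only [hexagonContract, ContinuousMap.coe_mk, ContinuousMap.id_apply, mul_eq_zero,
    Matrix.cons_val]
  tauto

/-- The contraction is a needed intermediary: at weights 0.7 and 0.3 on vertices 2 and 4, the
composite uses vertex 3, which is adjacent to 2, so the composite is not contiguous to the identity.
-/
theorem hexagonContract_homotopic :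
    (hexagonCycles.comp hexagonCollapse).Homotopic hexagonContract := by
  refine homotopic_of_forall_adj _ _ fun x => forall_adj_hexagon ?_
  have hx := hexagonCoords x
  simp only [mul_eq_zero]
  by_cases hle : progressRight x.1 ≤ progressLeft x.1
  · have h1 : ((hexagonCycles.comp hexagonCollapse) x).1 =
        leftCycle (wrap (progressLeft x.1) (oddWeight x.1)) := by
      simp only [ContinuousMap.comp_apply, hexagonCollapse, ContinuousMap.coe_mk, if_pos hle]
      exact leftCycle_circleDir hx.wrap_ne_zero
    obtain ⟨k1, k2, k3, k4⟩ := hx.wrap_contiguous hle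
      (X := (wrap (progressLeft x.1) (oddWeight x.1)).re)
      (Y := (wrap (progressLeft x.1) (oddWeight x.1)).im) rfl rfl
    rw [h1]
    simp only [hexagonContract, ContinuousMap.coe_mk, leftCycle, Matrix.cons_val]
    have p := fun u v => @pos_of_posShare_ne_zero u v
    grind
  · have h1 : ((hexagonCycles.comp hexagonCollapse) x).1 =
        rightCycle (wrap (progressRight x.1) (oddWeight x.1)) := by
      simp only [ContinuousMap.comp_apply, hexagonCollapse, ContinuousMap.coe_mk, if_neg hle]
      exact rightCycle_circleDir hx.swap.wrap_ne_zero
    obtain ⟨k1, k2, k3, k4⟩ := hx.swap.wrap_contiguous (not_le.mp hle).le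
      (X := (wrap (progressRight x.1) (oddWeight x.1)).re)
      (Y := (wrap (progressRight x.1) (oddWeight x.1)).im) rfl rfl
    rw [h1]
    simp only [hexagonContract, ContinuousMap.coe_mk, rightCycle, Matrix.cons_val]
    have p := fun u v => @pos_of_posShare_ne_zero u v
    grind

/-- The map from a circle around the square to itself that collapses the right side. -/
noncomputable def squareCollapse : C(Circle, Circle) where
  toFun z := circleDir (wrap (progressLeft (leftCycle z)) (oddWeight (leftCycle z)))
  continuous_toFun := by
    have h : Continuous fun z : Circle => leftCycle z :=
      continuous_subtype_val.comp (hexagonCycles.continuous.comp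
        (continuous_quot_mk.comp continuous_inl))
    exact Continuous.circleDir (continuous_wrap (continuous_progressLeft.comp h)
      (continuous_oddWeight.comp h))
      fun z => (hexagonCoords ⟨_, leftCycle_mem z.coe_ne_zero⟩).wrap_ne_zero

theorem progressRight_leftCycle (z : Circle) : progressRight (leftCycle z) = 0 := by
  have hs : 0 ≤ evenWeight (leftCycle z) := by
    have h := hexagonCoords ⟨_, leftCycle_mem z.coe_ne_zero⟩
    linarith [h.sum_a, h.a₀_nonneg, h.a₁_nonneg, h.a₂_nonneg]
  have ht : 0 ≤ oddWeight (leftCycle z) := by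
    have h := hexagonCoords ⟨_, leftCycle_mem z.coe_ne_zero⟩
    linarith [h.sum_b, h.b₀_nonneg, h.b₁_nonneg, h.b₂_nonneg]
  have e4 : leftCycle z 4 = 0 := rfl
  have e1 : leftCycle z 1 = 0 := rfl
  rw [progressRight, progress, e4, e1, max_eq_left (by linarith), max_eq_left (by linarith),
    add_zero]

theorem progress_nonneg (a b s t : ℝ) : 0 ≤ progress a b s t :=
  add_nonneg (le_max_left _ _) (le_max_left _ _)

theorem oddWeight_rightCycle (w : ℂ) : oddWeight (rightCycle w) = oddWeight (leftCycle w) := by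
  simp [oddWeight, leftCycle, rightCycle]

theorem evenWeight_rightCycle (w : ℂ) : evenWeight (rightCycle w) = evenWeight (leftCycle w) := by
  simp [evenWeight, leftCycle, rightCycle]

theorem progressRight_rightCycle (w : ℂ) :
    progressRight (rightCycle w) = progressLeft (leftCycle w) := by
  rw [progressRight, progressLeft, oddWeight_rightCycle, evenWeight_rightCycle]
  rfl

theorem progressLeft_rightCycle (w : ℂ) :
    progressLeft (rightCycle w) = progressRight (leftCycle w) := by
  rw [progressRight, progressLeft, oddWeight_rightCycle, evenWeight_rightCycle]
  rfl

theorem hexagonCollapse_inl (z : Circle) :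
    hexagonCollapse (hexagonCycles (Quot.mk _ (Sum.inl z))) =
      Quot.mk _ (Sum.inl (squareCollapse z)) := by
  change (if progressRight (leftCycle z) ≤ progressLeft (leftCycle z) then _ else _) = _
  rw [if_pos (by rw [progressRight_leftCycle]; exact progress_nonneg _ _ _ _)]
  rfl

theorem hexagonCollapse_inr (z : Circle) :
    hexagonCollapse (hexagonCycles (Quot.mk _ (Sum.inr z))) =
      Quot.mk _ (Sum.inr (squareCollapse z)) := by
  change (if progressRight (rightCycle z) ≤ progressLeft (rightCycle z)
    then Quot.mk _ (Sum.inl (circleDir (wrap (progressLeft (rightCycle z)) _)))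
    else Quot.mk _ (Sum.inr (circleDir (wrap (progressRight (rightCycle z))
      (oddWeight (rightCycle z)))))) = _
  rw [progressLeft_rightCycle, progressRight_leftCycle, progressRight_rightCycle,
    oddWeight_rightCycle]
  split_ifs with h
  -- The tie rule of `hexagonCollapse` sends these points to the left circle, but only to its base
  -- point.
  · have h0 : progressLeft (leftCycle z) = 0 := le_antisymm h (progress_nonneg _ _ _ _)
    have h1 : squareCollapse z = 1 := by
      change circleDir (wrap (progressLeft (leftCycle z)) _) = 1
      rw [h0, wrap_zero, circleDir_one]
    rw [h1, wrap_zero, circleDir_one]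
    exact Quot.sound WedgeRel.glue
  · rfl

theorem squareCollapse_one : squareCollapse 1 = 1 := by
  have h0 : progressLeft (leftCycle (1 : Circle)) = 0 := by
    simp [progressLeft, progress, leftCycle, evenWeight, oddWeight, posShare]
  change circleDir (wrap (progressLeft (leftCycle (1 : Circle))) _) = 1
  rw [h0, wrap_zero, circleDir_one]

theorem squareCollapse_ne_neg (z : Circle) : (squareCollapse z : ℂ) ≠ -z := by
  intro h
  have hne := (hexagonCoords ⟨_, leftCycle_mem z.coe_ne_zero⟩).wrap_ne_zero
  obtain ⟨r, hr, h1, h2⟩ := exists_pos_mul_circleDir hne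
  change ((circleDir (wrap (progressLeft (leftCycle z)) (oddWeight (leftCycle z))) : Circle) : ℂ)
    = -z at h
  have hz : (z : ℂ).re ^ 2 + (z : ℂ).im ^ 2 = 1 := by
    have := Circle.normSq_coe z
    rw [Complex.normSq_apply] at this
    linarith
  have hs : evenWeight (leftCycle z) = leftCycle z 0 + leftCycle z 2 := by
    simp [evenWeight, leftCycle]
  have ht : oddWeight (leftCycle z) = leftCycle z 3 + leftCycle z 5 := by
    simp [oddWeight, leftCycle]
  change (wrap (progressLeft (leftCycle z)) (oddWeight (leftCycle z))).re = r * (circleDir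
    (wrap (progressLeft (leftCycle z)) (oddWeight (leftCycle z))) : ℂ).re at h1
  change (wrap (progressLeft (leftCycle z)) (oddWeight (leftCycle z))).im = r * (circleDir
    (wrap (progressLeft (leftCycle z)) (oddWeight (leftCycle z))) : ℂ).im at h2
  rw [h, progressLeft, hs, ht, Complex.neg_re, mul_neg] at h1
  rw [h, progressLeft, hs, ht, Complex.neg_im, mul_neg] at h2
  exact wrap_square_ne hz hr rfl rfl rfl rfl h1 h2

/-- The independence complex of the hexagon is homotopy equivalent to a wedge of two circles. -/
theorem hexagon_homotopyEquiv : Nonempty (ContinuousMap.HomotopyEquiv HexagonComplex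
    (WedgeSum (1 : Circle) (1 : Circle))) := by
  refine ⟨⟨hexagonCollapse, hexagonCycles,
    hexagonContract_homotopic.trans id_homotopic_hexagonContract.symm, ?_⟩⟩
  obtain ⟨σ, hσ, hσ0, hσ1⟩ := exists_homotopy_id_of_ne_neg squareCollapse squareCollapse_one
    squareCollapse_ne_neg
  refine homotopic_of_wedge _ _
    ⟨fun p => Quot.mk _ (Sum.inl (σ p)), continuous_quot_mk.comp (continuous_inl.comp σ.continuous)⟩
    ⟨fun p => Quot.mk _ (Sum.inr (σ p)), continuous_quot_mk.comp (continuous_inr.comp σ.continuous)⟩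
    (fun s => ?_) (fun z => ?_) (fun z => ?_) (fun z => ?_) (fun z => ?_)
  · simp only [ContinuousMap.coe_mk, hσ]
    exact Quot.sound WedgeRel.glue
  · simp only [ContinuousMap.coe_mk, hσ0]
    exact (hexagonCollapse_inl z).symm
  · simp [hσ1]
  · simp only [ContinuousMap.coe_mk, hσ0]
    exact (hexagonCollapse_inr z).symm
  · simp [hσ1]

end HexagonHomotopyEquivalence

/-! ### The theorem -/

theorem theorem3 :
    (∀ (V : Type*) [Fintype V] (G : SimpleGraph V), G.IsBipartite → IsCircleGraph G →
      ∀ n : ℕ, 3 ≤ n → ∀ (X : Type*) [TopologicalSpace X], IsWedgeOfCircles n X →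
        ¬ Nonempty (ContinuousMap.HomotopyEquiv
          (geometricRealization (independenceComplex G)) X)) ∧
    ((SimpleGraph.cycleGraph 6).IsBipartite ∧ IsCircleGraph (SimpleGraph.cycleGraph 6) ∧
      Nonempty (ContinuousMap.HomotopyEquiv
        (geometricRealization (independenceComplex (SimpleGraph.cycleGraph 6)))
        (WedgeSum (1 : Circle) (1 : Circle)))) := by
  refine ⟨?_, isBipartite_cycleGraph_six, isCircleGraph_cycleGraph_six, hexagon_homotopyEquiv⟩
  rintro V _ G ⟨c⟩ ⟨D, rfl⟩ n hn X _ hX ⟨e⟩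
  obtain ⟨f, hf⟩ := hX.exists_independent hn e
  obtain ⟨a, b, ha, hb, hne, hab⟩ := exists_cube_of_independent c f hf
  -- `b j` distinguishes them: it is adjacent to `a i` but not to `a j`. Distinctness is needed to
  -- turn nonadjacency of equal colours into disjoint chords.
  have ha_ne : ∀ i j, i ≠ j → a i ≠ a j := fun i j hij h => hne j (h ▸ hab i j hij)
  refine D.no_cube a b (fun i j hij h => ?_) (fun i j hij => (hab i j hij).2) fun i h => ?_
  · exact c.valid (show D.intersectionGraph.Adj (a i) (a j) from ⟨ha_ne i j hij, h⟩)
      ((ha i).trans (ha j).symm)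
  · refine hne i ⟨fun h' => ?_, h⟩
    have := (ha i).symm.trans ((congrArg c h').trans (hb i))
    exact absurd this (by decide)
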